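/- Let $p,q\ge 1$ be integers with $p\neq q$ and $q\notin\{p+1,p+2\}$, and put $m=\min\{p,q\}$. Let $Q$ be the quadratic form on $\mathbb R^{p+q}$ with $Q(v)=\sum_{i\le p}v_i^2-\sum_{i>p}v_i^2$, fix a sign convention $\varepsilon\in\{1,-1\}$, and let $\mathbb R_{p,q}$ be the real Clifford algebra of $\mathbb R^{p+q}$ with relation $v\cdot v=\varepsilon\,Q(v)$. For $S=\{i_1<\dots<i_k\}$ write $e_S=e_{i_1}\cdots e_{i_k}$, and let $\sigma^*:\mathbb R_{p,q}\to\bigwedge^\bullet(\mathbb R^{p+q})^*$ be the symbol map, the linear isomorphism with $\sigma^*(e_{i_1}\cdots e_{i_k})=e^{i_1}\wedge\dots\wedge e^{i_k}$. Write $\langle a\rangle_k$ for the component of degree $k$ of $a\in\mathbb R_{p,q}$. A primitive idempotent is a nonzero idempotent that is not a sum of two nonzero orthogonal idempotents. The standard $\mathrm U(m)$-structure on $\mathbb R^{2m}$ is $(g_0,J_0,\omega_0)$, where $g_0$ is the standard inner product, $J_0e_k=e_{k+m}$, $J_0e_{k+m}=-e_k$ for $1\le k\le m$, and $\omega_0=g_0(J_0\cdot,\cdot)=\sum_{k=1}^m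 e^k\wedge e^{k+m}$. For a $2$-form $\omega$ put $P(\omega)=\sum_{k=0}^m\frac{\omega^k}{k!}$ and $P^{\mathbb Q}(\omega)=2^{-m}P(\omega)$. Then there are pairwise distinct indices $c(1),\dots,c(2m)\in\{1,\dots,p+q\}$, with complementary set of indices $D$, $|D|=p+q-2m$, such that the following holds. Put $s_j=e_{c(j)}e_{c(m+j)}$ for $1\le j\le m$, $\tilde f=\prod_{j=1}^m(1+s_j)$, and $\tilde\omega_0=\sum_{j=1}^m e^{c(j)}\wedge e^{c(m+j)}$, the pullback of $\omega_0$ under the projection $\mathbb R^{p+q}\to\mathbb R^{2m}$, $v\mapsto(v_{c(1)},\dots,v_{c(2m)})$. 1. The $s_j$ are commuting involutions, and $\tilde f$ recovers the $\mathrm U(m)$-structure $(g_0,J_0,\omega_0)$ by projection: $2m<p+q$; $\tilde f$ lies in the subalgebra $A$ generated by $e_{c(1)},\dots,e_{c(2m)}$; there is an algebra isomorphism $\mathbb R_{m,m}\cong A$ (same $\varepsilon$) with $e_k\mapsto e_{c(k)}$; and $\sigma^*$ restricts to a linear isomorphism $A\cong\bigwedge^\bullet(\mathbb R^{2m})^*$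 (reading $e^{c(k)}$ as $e^k$) that sends some element of $A$, which is a polynomial expression in the components $\langle\tilde f\rangle_k$, to $\omega_0$. More precisely, $\sigma^*(\langle\tilde f\rangle_2)=\tilde\omega_0$ and $\sigma^*(\tilde f)=P(\tilde\omega_0)$. 2. There are $r\ge 0$ and sets $\alpha_1,\dots,\alpha_r\subseteq D$ such that the $e_{\alpha_i}$ satisfy $e_{\alpha_i}^2=1$ and commute with each other and with all $s_j$, and such that, with $e=\prod_{i=1}^r\frac{1+e_{\alpha_i}}2$, the element $h=2^{-m}\tilde f e$ is a primitive idempotent of $\mathbb R_{p,q}$. 3. $\sigma^*(h)=P^{\mathbb Q}(\tilde\omega_0)\wedge\sigma^*(e)$, and $\sigma^*(e)$ lies in the subalgebra generated by the $e^i$ with $i\in D$, that is, it is (the pullback of) a form on the complementary $\mathbb R^{p+q-2m}$. -/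

import Mathlib

noncomputable section

/-! ### Real Clifford algebras -/

/-- The quadratic form of signature `(p, q)` on `ℝ^(p+q)`: the first `p` standard basis vectors
have `Q = 1`, the last `q` have `Q = -1`. -/
def sigForm (p q : ℕ) : QuadraticForm ℝ (Fin (p + q) → ℝ) :=
  QuadraticMap.weightedSumSquares ℝ (fun i : Fin (p + q) => if (i : ℕ) < p then (1 : ℝ) else -1)

/-- The Clifford algebra `ℝ_{p,q}` with relation `v * v = ε Q(v)`, `Q` of signature `(p, q)`.
The two sign conventions in use are `ε = 1` and `ε = -1`. -/
abbrev Cl (ε : ℝ) (p q : ℕ) : Type := CliffordAlgebra (ε • sigForm p q)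

/-- The standard generator `e_i` of `ℝ_{p,q}`. -/
def gen (ε : ℝ) (p q : ℕ) (i : Fin (p + q)) : Cl ε p q :=
  CliffordAlgebra.ι (ε • sigForm p q) (Pi.single i 1)

/-- The canonical basis monomial `e_S = e_{i_1} ⋯ e_{i_k}`, where `S = {i_1 < ⋯ < i_k}`. -/
def mono (ε : ℝ) (p q : ℕ) (S : Finset (Fin (p + q))) : Cl ε p q :=
  ((S.sort (· ≤ ·)).map (gen ε p q)).prod

theorem gen_mul_self (ε : ℝ) (p q : ℕ) (i : Fin (p + q)) :
    gen ε p q i * gen ε p q i =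
      algebraMap ℝ _ (ε * (if (i : ℕ) < p then (1 : ℝ) else -1)) := by
  rw [gen, CliffordAlgebra.ι_sq_scalar]
  congr 1
  simp [sigForm, QuadraticMap.weightedSumSquares_apply, Pi.single_apply]

/-- A primitive idempotent: a nonzero idempotent that is not the sum of two nonzero
orthogonal idempotents. -/
def IsPrimitiveIdempotent {R : Type*} [Ring R] (h : R) : Prop :=
  IsIdempotentElem h ∧ h ≠ 0 ∧
    ∀ a b : R, IsIdempotentElem a → IsIdempotentElem b → a * b = 0 → b * a = 0 →
      h = a + b → a = 0 ∨ b = 0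

/-! ### Exterior forms and the symbol map -/

/-- The algebra of exterior forms `⋀ (ℝ^n)*`; its product is the wedge product. -/
abbrev Form (n : ℕ) : Type := ExteriorAlgebra ℝ (Module.Dual ℝ (Fin n → ℝ))

/-- The covector `e^i` of the dual basis, as a form of degree one. -/
def covec {n : ℕ} (i : Fin n) : Form n :=
  ExteriorAlgebra.ι ℝ (LinearMap.proj i : Module.Dual ℝ (Fin n → ℝ))

/-- The value `ω(v, w)` of the degree two part of a form. -/
def evalTwo {n : ℕ} (ω : Form n) (v w : Fin n → ℝ) : ℝ :=
  ExteriorAlgebra.algebraMapInv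
    (CliffordAlgebra.contractLeft (Module.Dual.eval ℝ (Fin n → ℝ) w)
      (CliffordAlgebra.contractLeft (Module.Dual.eval ℝ (Fin n → ℝ) v) ω))

/-- The symbol map `σ* : ℝ_{p,q} → ⋀ (ℝ^(p+q))*`: Mathlib's linear isomorphism of the Clifford
algebra with the exterior algebra, followed by `e_i ↦ e^i`. By `symbol_mono` below, it is the
linear map with `σ*(e_{i_1} ⋯ e_{i_k}) = e^{i_1} ∧ ⋯ ∧ e^{i_k}`. -/
def symbol (ε : ℝ) (p q : ℕ) : Cl ε p q →ₗ[ℝ] Form (p + q) :=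
  (ExteriorAlgebra.map
      ((Pi.basisFun ℝ (Fin (p + q))).toDual)).toLinearMap ∘ₗ
    (CliffordAlgebra.equivExterior (ε • sigForm p q)).toLinearMap

theorem associated_single (ε : ℝ) (p q : ℕ) {i j : Fin (p + q)} (hij : i ≠ j) :
    QuadraticMap.associated (R := ℝ) (-(ε • sigForm p q))
      (Pi.single i 1 : Fin (p + q) → ℝ) (Pi.single j 1) = 0 := by
  have h : ∀ k : Fin (p + q),
      ((Pi.single i 1 : Fin (p + q) → ℝ) k) * ((Pi.single j 1 : Fin (p + q) → ℝ) k) = 0 := by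
    intro k
    by_cases hk : k = i
    · subst hk; simp [hij]
    · simp [Pi.single_apply, hk]
  rw [QuadraticMap.associated_apply]
  simp only [neg_apply, smul_apply, sigForm,
    QuadraticMap.weightedSumSquares_apply, Pi.add_apply, smul_eq_mul]
  have : ∀ w : Fin (p + q) → ℝ, ∑ k, w k *
      (((Pi.single i 1 : Fin (p + q) → ℝ) k + (Pi.single j 1 : Fin (p + q) → ℝ) k) *
        ((Pi.single i 1 : Fin (p + q) → ℝ) k + (Pi.single j 1 : Fin (p + q) → ℝ) k)) =
      ∑ k, w k * ((Pi.single i 1 : Fin (p + q) → ℝ) k * (Pi.single i 1 : Fin (p + q) → ℝ) k) +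
      ∑ k, w k * ((Pi.single j 1 : Fin (p + q) → ℝ) k * (Pi.single j 1 : Fin (p + q) → ℝ) k) := by
    intro w
    rw [← Finset.sum_add_distrib]
    refine Finset.sum_congr rfl fun k _ => ?_
    linear_combination 2 * w k * h k
  rw [this]
  have h0 : ∀ x y : ℝ, -(ε * (x + y)) - -(ε * x) - -(ε * y) = 0 := fun x y => by ring
  rw [h0, smul_zero]

theorem contractLeft_list_prod {M : Type*} [AddCommGroup M] [Module ℝ M]
    (d : Module.Dual ℝ M) (l : List M) (h : ∀ x ∈ l, d x = 0) :
    CliffordAlgebra.contractLeft (Q := (0 : QuadraticForm ℝ M)) d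
      ((l.map (ExteriorAlgebra.ι ℝ (M := M))).prod : ExteriorAlgebra ℝ M) = 0 := by
  induction l with
  | nil => exact CliffordAlgebra.contractLeft_one (Q := (0 : QuadraticForm ℝ M)) (d := d)
  | cons a l ih =>
    rw [List.map_cons, List.prod_cons]
    refine (CliffordAlgebra.contractLeft_ι_mul (Q := (0 : QuadraticForm ℝ M)) d a _).trans ?_
    rw [h a (by simp), ih (fun x hx => h x (by simp [hx]))]
    simp

theorem equivExterior_list_prod (ε : ℝ) (p q : ℕ) (l : List (Fin (p + q))) (hl : l.Nodup) :
    CliffordAlgebra.equivExterior (ε • sigForm p q) ((l.map (gen ε p q)).prod) =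
      ((l.map fun i => (Pi.single i 1 : Fin (p + q) → ℝ)).map (ExteriorAlgebra.ι ℝ)).prod := by
  induction l with
  | nil =>
    simp only [List.map_nil, List.prod_nil, CliffordAlgebra.equivExterior,
      CliffordAlgebra.changeFormEquiv_apply]
    exact CliffordAlgebra.changeForm_one _
  | cons a l ih =>
    have ih := ih hl.of_cons
    rw [List.map_cons, List.map_cons, List.map_cons, List.prod_cons, List.prod_cons, ← ih]
    simp only [CliffordAlgebra.equivExterior, CliffordAlgebra.changeFormEquiv_apply] at ih ⊢
    rw [gen, CliffordAlgebra.changeForm_ι_mul, ih, contractLeft_list_prod, sub_zero]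
    · intro x hx
      obtain ⟨b, hb, rfl⟩ := List.mem_map.1 hx
      exact associated_single ε p q (fun hab => (List.nodup_cons.1 hl).1 (hab ▸ hb))

/-- The defining property of the symbol map. -/
theorem symbol_mono (ε : ℝ) (p q : ℕ) (S : Finset (Fin (p + q))) :
    symbol ε p q (mono ε p q S) = ((S.sort (· ≤ ·)).map covec).prod := by
  have hd : ∀ i : Fin (p + q), (Pi.basisFun ℝ (Fin (p + q))).toDual (Pi.single i 1) =
      (LinearMap.proj i : Module.Dual ℝ (Fin (p + q) → ℝ)) := by
    intro i
    refine LinearMap.ext fun v => ?_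
    have h2 := (Pi.basisFun ℝ (Fin (p + q))).toDual_apply_right i v
    simpa using h2
  rw [symbol, LinearMap.comp_apply, mono]
  erw [equivExterior_list_prod ε p q _ (Finset.sort_nodup _ _)]
  rw [AlgHom.toLinearMap_apply, map_list_prod, List.map_map, List.map_map]
  congr 1
  refine List.map_congr_left fun i _ => ?_
  simp only [Function.comp_apply, ExteriorAlgebra.map_apply_ι, hd, covec]

/-- The degree `k` component `⟨a⟩_k` of a Clifford element. -/
def gradePart (ε : ℝ) (p q k : ℕ) (a : Cl ε p q) : Cl ε p q :=
  (CliffordAlgebra.equivExterior (ε • sigForm p q)).symm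
    (GradedRing.proj (fun i : ℕ => ⋀[ℝ]^i (Fin (p + q) → ℝ)) k
      (CliffordAlgebra.equivExterior (ε • sigForm p q) a))

/-- For a choice `c` of `n` among `N` coordinates: the embedding `⋀ (ℝ^n)* → ⋀ (ℝ^N)*`,
`e^k ↦ e^(c k)`, that is, the pullback of forms along the projection `ℝ^N → ℝ^n`,
`v ↦ (k ↦ v (c k))`. -/
def pull {n N : ℕ} (c : Fin n ↪ Fin N) : Form n →ₐ[ℝ] Form N :=
  ExteriorAlgebra.map (LinearMap.funLeft ℝ ℝ c).dualMap

theorem pull_covec {n N : ℕ} (c : Fin n ↪ Fin N) (k : Fin n) :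
    pull c (covec k) = covec (c k) := by
  rw [pull, covec, ExteriorAlgebra.map_apply_ι]
  rfl

/-! ### `U(m)`-structures and the Kähler polynomial -/

/-- A (linear) `U(m)`-structure on `ℝ^(2m)`: a Euclidean inner product `g`, an orthogonal
complex structure `J`, and the two-form `ω(v, w) = g(J v, w)`. -/
structure UnitaryStructure (m : ℕ) where
  g : LinearMap.BilinForm ℝ (Fin (m + m) → ℝ)
  J : (Fin (m + m) → ℝ) →ₗ[ℝ] (Fin (m + m) → ℝ)
  ω : Form (m + m)
  g_symm : ∀ v w, g v w = g w v
  g_pos : ∀ v, v ≠ 0 → 0 < g v v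
  J_sq : ∀ v, J (J v) = -v
  g_J : ∀ v w, g (J v) (J w) = g v w
  ω_mem : ω ∈ ⋀[ℝ]^2 (Module.Dual ℝ (Fin (m + m) → ℝ))
  ω_eval : ∀ v w, evalTwo ω v w = g (J v) w

/-- The standard inner product `g₀` of `ℝ^n`. -/
def stdInner (n : ℕ) : LinearMap.BilinForm ℝ (Fin n → ℝ) := dotProductBilin ℝ ℝ

/-- The complex structure `J₀` of `ℝ^(2m)`: `J₀ e_k = e_{k+m}`, `J₀ e_{k+m} = -e_k`. -/
def stdComplex (m : ℕ) : (Fin (m + m) → ℝ) →ₗ[ℝ] (Fin (m + m) → ℝ) where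
  toFun v := Fin.append (fun k => -v (Fin.natAdd m k)) (fun k => v (Fin.castAdd m k))
  map_add' v w := by
    funext i
    refine Fin.addCases (fun k => ?_) (fun k => ?_) i <;>
      simp [add_comm, -Fin.natAdd_eq_addNat]
  map_smul' a v := by
    funext i
    refine Fin.addCases (fun k => ?_) (fun k => ?_) i <;>
      simp [-Fin.natAdd_eq_addNat]

/-- The Kähler form `ω₀ = e^1 ∧ e^(m+1) + ⋯ + e^m ∧ e^(2m)` of `ℝ^(2m)`. -/
def stdKahler (m : ℕ) : Form (m + m) :=
  ∑ k : Fin m, covec (Fin.castAdd m k) * covec (Fin.natAdd m k)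

theorem evalTwo_covec_mul {n : ℕ} (i j : Fin n) (v w : Fin n → ℝ) :
    evalTwo (covec i * covec j) v w = v i * w j - v j * w i := by
  have h1 : CliffordAlgebra.contractLeft (Module.Dual.eval ℝ (Fin n → ℝ) v)
      (covec i * covec j) = v i • covec j - v j • covec i := by
    refine (CliffordAlgebra.contractLeft_ι_mul
      (Q := (0 : QuadraticForm ℝ (Module.Dual ℝ (Fin n → ℝ)))) _ _ _).trans ?_
    congr 1
    erw [CliffordAlgebra.contractLeft_ι]
    rw [← Algebra.commutes, ← Algebra.smul_def]
    rfl
  have h2 : ∀ k : Fin n, CliffordAlgebra.contractLeft (Module.Dual.eval ℝ (Fin n → ℝ) w)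
      (covec k) = algebraMap ℝ (Form n) (w k) := fun k =>
    CliffordAlgebra.contractLeft_ι _ _ _
  rw [evalTwo, h1, map_sub, map_smul, map_smul, h2, h2]
  simp

/-- `ω₀(v, w) = g₀(J₀ v, w)`. -/
theorem evalTwo_stdKahler (m : ℕ) (v w : Fin (m + m) → ℝ) :
    evalTwo (stdKahler m) v w = stdInner (m + m) (stdComplex m v) w := by
  have h : evalTwo (stdKahler m) v w =
      ∑ k : Fin m, evalTwo (covec (Fin.castAdd m k) * covec (Fin.natAdd m k)) v w := by
    simp only [evalTwo, stdKahler, map_sum]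
  rw [h]
  simp only [evalTwo_covec_mul, stdInner, dotProductBilin_apply_apply, dotProduct,
    Fin.sum_univ_add, stdComplex, LinearMap.coe_mk, AddHom.coe_mk, Fin.append_left,
    Fin.append_right, ← Finset.sum_add_distrib]
  refine Finset.sum_congr rfl fun k _ => ?_
  ring

/-- The standard `U(m)`-structure `(g₀, J₀, ω₀)` of `ℝ^(2m)`. -/
def stdUnitary (m : ℕ) : UnitaryStructure m where
  g := stdInner (m + m)
  J := stdComplex m
  ω := stdKahler m
  g_symm v w := by simp [stdInner, dotProduct_comm]
  g_pos v hv := by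
    have h := dotProduct_self_eq_zero (v := v)
    have h0 : 0 ≤ v ⬝ᵥ v := Finset.sum_nonneg fun i _ => mul_self_nonneg (v i)
    simp only [stdInner, dotProductBilin_apply_apply]
    exact lt_of_le_of_ne h0 fun h' => hv (h.1 h'.symm)
  J_sq v := by
    funext i
    refine Fin.addCases (fun k => ?_) (fun k => ?_) i <;>
      simp [stdComplex, -Fin.natAdd_eq_addNat]
  g_J v w := by
    simp [stdInner, stdComplex, dotProduct, Fin.sum_univ_add, add_comm, -Fin.natAdd_eq_addNat]
  ω_mem := by
    refine Submodule.sum_mem _ fun k _ => ?_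
    change _ ∈ LinearMap.range (ExteriorAlgebra.ι ℝ) ^ 2
    rw [pow_two]
    exact Submodule.mul_mem_mul (LinearMap.mem_range_self _ _) (LinearMap.mem_range_self _ _)
  ω_eval := evalTwo_stdKahler m

/-- The Kähler polynomial `P(ω) = ∑_{k=0}^m ω^k / k!`. -/
def kahlerPoly {n : ℕ} (m : ℕ) (ω : Form n) : Form n :=
  ∑ k ∈ Finset.range (m + 1), ((k.factorial : ℝ)⁻¹) • ω ^ k

/-- The rational Kähler polynomial `P^ℚ(ω) = 2^{-m} P(ω)`. -/
def ratKahlerPoly {n : ℕ} (m : ℕ) (ω : Form n) : Form n :=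
  ((2 : ℝ) ^ m)⁻¹ • kahlerPoly m ω

/-! ### Recovery by projection -/

/-- The subalgebra of `ℝ_{p,q}` generated by the basis vectors `e_{c k}`. -/
def coordSubalgebra (ε : ℝ) (p q : ℕ) {n : ℕ} (c : Fin n ↪ Fin (p + q)) :
    Subalgebra ℝ (Cl ε p q) :=
  Algebra.adjoin ℝ (Set.range fun k => gen ε p q (c k))

/-- The `U(m)`-structure `U` on `ℝ^(2m)` is recovered by projection from `f ∈ ℝ_{p,q}`, along the
coordinates `c`: here `p + q > 2m`, the subalgebra `A` generated by the `e_{c k}` is a copy of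
`ℝ_{m,m}` containing `f`, the symbol map restricts to an isomorphism `τ : A ≅ ⋀ (ℝ^(2m))*`
(with `e^k` read as `e^(c k)`), and `τ` sends some algebraic expression `ψ ∈ A` in the graded
components of `f` to the form `ω` of `U`. -/
structure RecoversByProjection (ε : ℝ) (p q : ℕ) {m : ℕ} (c : Fin (m + m) ↪ Fin (p + q))
    (f : Cl ε p q) (U : UnitaryStructure m) : Prop where
  dim_lt : m + m < p + q
  mem : f ∈ coordSubalgebra ε p q c
  iso : ∃ Φ : Cl ε m m ≃ₐ[ℝ] coordSubalgebra ε p q c,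
    ∀ k, (Φ (gen ε m m k) : Cl ε p q) = gen ε p q (c k)
  recovers : ∃ τ : coordSubalgebra ε p q c ≃ₗ[ℝ] Form (m + m),
    (∀ a, pull c (τ a) = symbol ε p q (a : Cl ε p q)) ∧
    ∃ ψ : coordSubalgebra ε p q c,
      (ψ : Cl ε p q) ∈ Algebra.adjoin ℝ (Set.range fun k : ℕ => gradePart ε p q k f) ∧
      τ ψ = U.ω

end

/-! Take for `c` the first `m` positive and the first `m` negative coordinates. Each `s_j` is then a
product of two anticommuting generators with squares of opposite sign, so it squares to `1`; being
even products in disjoint generators, the `s_j` commute. On disjoint sets of generators the Clifford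
product is carried to the wedge product (`equivExterior_mul_of_disjoint`), so `∏ (1 + s_j)` has
symbol `∏ (1 + e^{c j} ∧ e^{c (m+j)})`. The factors commute and their bivectors square to zero, so
this is the truncated exponential of the Kähler form (`prod_one_add_eq_sum_pow`), and its degree two
part is the form itself.

The sets `α_i` are not constructed explicitly. A maximal list of distinct commuting monomials of
square `1` in the complementary generators is chosen, subject to the product `h` of all the
idempotents being nonzero (`exists_maximal_isAdmissible`). Maximality replaces any count of how many
idempotents are needed.

Primitivity is read off the corner `h R h`, which is spanned by compressed monomials. A monomial
anticommuting with one of the chosen involutions compresses to zero. One that commutes with all of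
them and squares to `1` is, up to sign, a product of some `s_j` and a complementary monomial, which
maximality forces to act on `h` by a sign. What remains are monomials of square `-1`, and these
generate at most a quotient of the quaternions (`isPrimitiveIdempotent_of_monomials`), where a norm
argument leaves only the idempotents `0` and `h`. Since only actions up to sign matter, signs of
reordered products are never computed; this is the role of `SignEq`. -/

noncomputable section

/-! ### Equality up to sign -/

/-- `x` and `y` agree up to sign. -/
def SignEq {R : Type*} [Ring R] (x y : R) : Prop := x = y ∨ x = -y

namespace SignEq

variable {R : Type*} [Ring R] {x y z x' y' : R}

theorem refl (x : R) : SignEq x x := Or.inl rfl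

theorem symm (h : SignEq x y) : SignEq y x := by
  rcases h with rfl | rfl
  · exact Or.inl rfl
  · exact Or.inr (neg_neg _).symm

theorem trans (h : SignEq x y) (h' : SignEq y z) : SignEq x z := by
  rcases h with rfl | rfl <;> rcases h' with rfl | rfl <;> simp [SignEq]

theorem mul (h : SignEq x y) (h' : SignEq x' y') : SignEq (x * x') (y * y') := by
  rcases h with rfl | rfl <;> rcases h' with rfl | rfl <;> simp [SignEq]

theorem mul_self_eq (h : SignEq x y) : x * x = y * y := by
  rcases h with rfl | rfl <;> simp

theorem commute_left (h : SignEq x y) (hz : Commute x z) : Commute y z := by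
  rcases h with rfl | rfl
  · exact hz
  · simpa using hz

end SignEq

/-! ### A criterion for primitivity -/

section Primitive

variable {R : Type*} [Ring R]

/-- In an orthogonal decomposition `h = a + b` the summand `a` satisfies `h a h = a`, so only
idempotents of the corner can occur. -/
theorem isPrimitiveIdempotent_of_corner {h : R} (hi : IsIdempotentElem h) (h0 : h ≠ 0)
    (H : ∀ x : R, h * x * h = x → x * x = x → x = 0 ∨ x = h) : IsPrimitiveIdempotent h := by
  refine ⟨hi, h0, fun a b ha hb hab hba hs => ?_⟩
  have ha' : h * a * h = a := by
    rw [hs]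
    simp [add_mul, mul_add, ha.eq, hab, hba]
  rcases H a ha' ha.eq with h1 | h1
  · exact Or.inl h1
  · right
    rw [hs] at h1
    simpa using h1.symm

variable [Algebra ℝ R]

/-- In a corner that is spanned by `h, u, v, u v` with anticommuting `u`, `v` of square `-h`
(a quotient of the quaternions), the only idempotents are `0` and `h`. -/
theorem eq_zero_or_eq_of_quaternion {h u v x : R} (hi : h * h = h)
    (hu : h * u = u) (hu' : u * h = u) (hv : h * v = v) (hv' : v * h = v)
    (uu : u * u = -h) (vv : v * v = -h) (vu : v * u = -(u * v)) (a b c d : ℝ)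
    (hx : x = a • h + b • u + c • v + d • (u * v)) (hxx : x * x = x) : x = 0 ∨ x = h := by
  have e1 : u * (u * v) = -v := by rw [← mul_assoc, uu, neg_mul, hv]
  have e2 : v * (u * v) = u := by rw [← mul_assoc, vu, neg_mul, mul_assoc, vv]; simp [hu']
  have e3 : (u * v) * u = v := by rw [mul_assoc, vu, mul_neg, e1, neg_neg]
  have e4 : (u * v) * v = -u := by rw [mul_assoc, vv]; simp [hu']
  have e5 : (u * v) * (u * v) = -h := by rw [mul_assoc, e2, uu]
  have e6 : h * (u * v) = u * v := by rw [← mul_assoc, hu]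
  have e7 : (u * v) * h = u * v := by rw [mul_assoc, hv']
  -- Conjugate times `x` is the norm. No linear independence of `h, u, v, uv` is needed: multiplying
  -- once more by `x = x * x` gives `N • x = N • h`.
  have hN : (a • h - b • u - c • v - d • (u * v)) * x =
      (a ^ 2 + b ^ 2 + c ^ 2 + d ^ 2) • h := by
    rw [hx]
    simp only [mul_add, sub_mul, smul_mul_smul_comm, hi, hu, hu', hv, hv', uu, vv, vu,
      e1, e2, e3, e4, e5, e6, e7]
    module
  have hhx : h * x = x := by
    rw [hx]; simp only [mul_add, mul_smul_comm, hi, hu, hv, e6]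
  have key : (a ^ 2 + b ^ 2 + c ^ 2 + d ^ 2) • x = (a ^ 2 + b ^ 2 + c ^ 2 + d ^ 2) • h := by
    rw [← hN]
    nth_rw 2 [← hxx]
    rw [← mul_assoc, hN, smul_mul_assoc, hhx]
  by_cases h0 : a ^ 2 + b ^ 2 + c ^ 2 + d ^ 2 = 0
  · left
    have ha : a = 0 := by nlinarith [sq_nonneg a, sq_nonneg b, sq_nonneg c, sq_nonneg d]
    have hb : b = 0 := by nlinarith [sq_nonneg a, sq_nonneg b, sq_nonneg c, sq_nonneg d]
    have hc : c = 0 := by nlinarith [sq_nonneg a, sq_nonneg b, sq_nonneg c, sq_nonneg d]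
    have hd : d = 0 := by nlinarith [sq_nonneg a, sq_nonneg b, sq_nonneg c, sq_nonneg d]
    rw [hx, ha, hb, hc, hd]
    simp
  · exact Or.inr (smul_right_injective R h0 key)

/-- The case of a corner spanned by `h` and `u` with `u ^ 2 = -h`. -/
theorem eq_zero_or_eq_of_complex {h u x : R} (hi : h * h = h)
    (hu : h * u = u) (hu' : u * h = u) (uu : u * u = -h) (a b : ℝ)
    (hx : x = a • h + b • u) (hxx : x * x = x) : x = 0 ∨ x = h := by
  have hN : (a • h - b • u) * x = (a ^ 2 + b ^ 2) • h := by
    rw [hx]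
    simp only [mul_add, sub_mul, smul_mul_smul_comm, hi, hu, hu', uu]
    module
  have hhx : h * x = x := by
    rw [hx]; simp only [mul_add, mul_smul_comm, hi, hu]
  have key : (a ^ 2 + b ^ 2) • x = (a ^ 2 + b ^ 2) • h := by
    rw [← hN]
    nth_rw 2 [← hxx]
    rw [← mul_assoc, hN, smul_mul_assoc, hhx]
  by_cases h0 : a ^ 2 + b ^ 2 = 0
  · left
    have ha : a = 0 := by nlinarith [sq_nonneg a, sq_nonneg b]
    have hb : b = 0 := by nlinarith [sq_nonneg a, sq_nonneg b]
    rw [hx, ha, hb]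
    simp
  · exact Or.inr (smul_right_injective R h0 key)

/-- Compression `y ↦ h y h` is linear and fixes the corner, so the corner is spanned by the
compressed generators. -/
theorem corner_mem_of_span {G : Set R} (hspan : Submodule.span ℝ G = ⊤) {h : R}
    {N : Submodule ℝ R} (H : ∀ a ∈ G, h * a * h ∈ N) {x : R} (hx : h * x * h = x) : x ∈ N := by
  have : ∀ y ∈ Submodule.span ℝ G, h * y * h ∈ N := by
    intro y hy
    induction hy using Submodule.span_induction with
    | mem y hy => exact H y hy
    | zero => simp
    | add y z _ _ hy hz => rw [mul_add, add_mul]; exact N.add_mem hy hz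
    | smul t y _ hy => rw [mul_smul_comm, smul_mul_assoc]; exact N.smul_mem t hy
  rw [← hx]
  exact this x (hspan ▸ Submodule.mem_top)

/-- Let `R` be spanned by monomials which square to `±1`, commute or anticommute, and are closed
under products up to sign. An idempotent `h` is primitive if every monomial either commutes with
`h` or is killed by compression to the corner of `h`, and if the commuting monomials of square `1`
act on `h` by a sign: the corner is then a copy of `ℝ`, `ℂ` or the quaternions. -/
theorem isPrimitiveIdempotent_of_monomials {G : Set R} (hspan : Submodule.span ℝ G = ⊤)
    (hmul : ∀ a ∈ G, ∀ b ∈ G, ∃ c ∈ G, SignEq (a * b) c)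
    (hsq : ∀ a ∈ G, SignEq (a * a) 1)
    (hcomm : ∀ a ∈ G, ∀ b ∈ G, SignEq (a * b) (b * a)) {h : R}
    (hi : IsIdempotentElem h) (h0 : h ≠ 0) (hG : ∀ a ∈ G, h * a * h = 0 ∨ Commute a h)
    (hone : ∀ a ∈ G, Commute a h → a * a = 1 → SignEq (a * h) h) :
    IsPrimitiveIdempotent h := by
  refine isPrimitiveIdempotent_of_corner hi h0 fun x hx hxx => ?_
  have hi' : h * h = h := hi
  have hcor : ∀ a, Commute a h → h * a * h = a * h := fun a ha => by
    rw [← ha.eq, mul_assoc, hi']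
  have hsm : ∀ {N : Submodule ℝ R} {y z : R}, SignEq y z → z ∈ N → y ∈ N := by
    rintro N y z (rfl | rfl) hz
    · exact hz
    · exact N.neg_mem hz
  -- For commuting `a`, `b` of square `-1`, the product `a b` has square `1` and hence acts on `h`
  -- by a sign; multiplying by `-a = a⁻¹` gives `b h = ± a h`.
  have hsame : ∀ a ∈ G, ∀ b ∈ G, Commute a h → Commute b h → a * a = -1 → b * b = -1 →
      Commute a b → SignEq (b * h) (a * h) := by
    intro a ha b hb hah hbh haa hbb hab
    obtain ⟨c, hc, hac⟩ := hmul a ha b hb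
    have hcc : c * c = 1 := by
      rw [← hac.mul_self_eq, hab.symm.mul_mul_mul_comm, haa, hbb]; simp
    have h1 : SignEq (a * b * h) h :=
      (hac.mul (SignEq.refl h)).trans (hone c hc (hac.commute_left (hah.mul_left hbh)) hcc)
    have h2 := (SignEq.refl (-a)).mul h1
    have h3 : -a * (a * b * h) = b * h := by
      rw [← mul_assoc, ← mul_assoc, neg_mul, haa]; simp
    rw [h3] at h2
    exact h2.trans (by simp [SignEq])
  -- Without such an `i` the corner is `ℝ h`. With `i`, but no anticommuting partner `j`, it is
  -- spanned by `h` and `i h`.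
  by_cases hI : ∃ i ∈ G, Commute i h ∧ i * i = -1
  swap
  · have := corner_mem_of_span hspan (N := Submodule.span ℝ {h}) (h := h) (fun a ha => by
      rcases hG a ha with h1 | h1
      · rw [h1]; exact zero_mem _
      · rw [hcor a h1]
        rcases hsq a ha with h2 | h2
        · exact hsm (hone a ha h1 h2) (Submodule.mem_span_singleton_self h)
        · exact absurd ⟨a, ha, h1, h2⟩ hI) hx
    obtain ⟨a, rfl⟩ := Submodule.mem_span_singleton.1 this
    rw [smul_mul_smul_comm, hi'] at hxx
    have h1 := smul_left_injective ℝ h0 hxx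
    have h2 : a * (a - 1) = 0 := by linear_combination h1
    rcases mul_eq_zero.1 h2 with h3 | h3
    · left; simp [h3]
    · right; rw [sub_eq_zero.1 h3, one_smul]
  obtain ⟨i, hiG, hih, hii⟩ := hI
  have hcu : ∀ a, Commute a h → h * (a * h) = a * h := fun a ha => by
    rw [← mul_assoc]; exact hcor a ha
  have hcu' : ∀ a, a * h * h = a * h := fun a => by rw [mul_assoc, hi']
  have hmm : ∀ a b, Commute b h → (a * h) * (b * h) = a * b * h := fun a b hb => by
    rw [mul_assoc, ← mul_assoc h, hcor b hb, mul_assoc]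
  by_cases hJ : ∃ j ∈ G, Commute j h ∧ j * j = -1 ∧ ¬ Commute i j
  swap
  · push Not at hJ
    have := corner_mem_of_span hspan (N := Submodule.span ℝ {h, i * h}) (h := h) (fun a ha => by
      rcases hG a ha with h1 | h1
      · rw [h1]; exact zero_mem _
      · rw [hcor a h1]
        rcases hsq a ha with h2 | h2
        · exact hsm (hone a ha h1 h2) (Submodule.subset_span (by simp))
        · exact hsm (hsame i hiG a ha hih h1 hii h2 (hJ a ha h1 h2))
            (Submodule.subset_span (by simp))) hx
    obtain ⟨a, b, hab⟩ := Submodule.mem_span_pair.1 this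
    exact eq_zero_or_eq_of_complex hi' (hcu i hih) (hcu' i)
      (by rw [hmm i i hih, hii]; simp) a b hab.symm hxx
  obtain ⟨j, hjG, hjh, hjj, hij⟩ := hJ
  have hanti : ∀ a ∈ G, ∀ b ∈ G, ¬ Commute a b → a * b = -(b * a) := fun a ha b hb hab =>
    (hcomm a ha b hb).resolve_left hab
  have hji : j * i = -(i * j) := hanti j hjG i hiG fun h1 => hij h1.symm
  obtain ⟨k, hkG, hk⟩ := hmul i hiG j hjG
  have hkh : Commute k h := hk.commute_left (hih.mul_left hjh)
  have hkk : k * k = -1 := by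
    rw [← hk.mul_self_eq, mul_assoc, ← mul_assoc j, hji, neg_mul, mul_neg, mul_assoc, hjj,
      ← mul_assoc, hii]
    simp
  have := corner_mem_of_span hspan (N := Submodule.span ℝ {h, i * h, j * h, i * j * h}) (h := h)
    (fun a ha => by
      rcases hG a ha with h1 | h1
      · rw [h1]; exact zero_mem _
      · rw [hcor a h1]
        rcases hsq a ha with h2 | h2
        · exact hsm (hone a ha h1 h2) (Submodule.subset_span (by simp))
        · by_cases hia : Commute i a
          · exact hsm (hsame i hiG a ha hih h1 hii h2 hia) (Submodule.subset_span (by simp))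
          by_cases hja : Commute j a
          · exact hsm (hsame j hjG a ha hjh h1 hjj h2 hja) (Submodule.subset_span (by simp))
          -- An element anticommuting with both `i` and `j` commutes with `i j`, which also has
          -- square `-1`; so `hsame` applies and no fourth imaginary unit appears.
          have hka : Commute (i * j) a := by
            have e1 := hanti i hiG a ha hia
            have e2 := hanti j hjG a ha hja
            change i * j * a = a * (i * j)
            rw [mul_assoc, e2, mul_neg, ← mul_assoc, e1, neg_mul, neg_neg, mul_assoc]
          exact hsm ((hsame k hkG a ha hkh h1 hkk h2 (hk.commute_left hka)).trans
            (hk.symm.mul (SignEq.refl h))) (Submodule.subset_span (by simp))) hx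
  obtain ⟨a, y, hy, rfl⟩ := Submodule.mem_span_insert.1 this
  obtain ⟨b, z, hz, rfl⟩ := Submodule.mem_span_insert.1 hy
  obtain ⟨c, d, rfl⟩ := Submodule.mem_span_pair.1 hz
  refine eq_zero_or_eq_of_quaternion hi' (hcu i hih) (hcu' i) (hcu j hjh) (hcu' j)
      (by rw [hmm i i hih, hii]; simp) (by rw [hmm j j hjh, hjj]; simp) ?_ a b c d ?_ hxx
  · rw [hmm j i hih, hmm i j hjh, hji, neg_mul]
  · rw [hmm i j hjh]; abel

end Primitive

/-! ### Products of commuting idempotents -/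

section HalfProd

variable {R : Type*} [Ring R] [Algebra ℝ R]

/-- The product of the `(1 + x) / 2` over a list. -/
def halfProd (K : List R) : R := (K.map fun x => (2 : ℝ)⁻¹ • (1 + x)).prod

@[simp] theorem halfProd_nil : halfProd ([] : List R) = 1 := rfl

@[simp] theorem halfProd_cons (x : R) (K : List R) :
    halfProd (x :: K) = ((2 : ℝ)⁻¹ • (1 + x)) * halfProd K := by
  simp [halfProd]

theorem halfProd_append (K L : List R) : halfProd (K ++ L) = halfProd K * halfProd L := by
  simp [halfProd]

theorem halfProd_eq_smul (K : List R) :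
    halfProd K = ((2 : ℝ) ^ K.length)⁻¹ • (K.map fun x => 1 + x).prod := by
  induction K with
  | nil => simp
  | cons x K ih =>
    rw [halfProd_cons, ih, List.map_cons, List.prod_cons, smul_mul_smul_comm, List.length_cons,
      pow_succ', mul_inv]

theorem commute_halfProd {K : List R} {y : R} (hy : ∀ x ∈ K, Commute y x) :
    Commute y (halfProd K) := by
  refine Commute.list_prod_right _ _ fun z hz => ?_
  obtain ⟨x, hx, rfl⟩ := List.mem_map.1 hz
  exact ((Commute.one_right y).add_right (hy x hx)).smul_right _

/-- The factor `(1 + x) / 2` absorbs `x` because `x * x = 1`, and `x` commutes past the factors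
before it. -/
theorem mul_halfProd_of_mem {K : List R} (hK : ∀ x ∈ K, ∀ y ∈ K, Commute x y)
    (hsq : ∀ x ∈ K, x * x = 1) {x : R} (hx : x ∈ K) : x * halfProd K = halfProd K := by
  induction K with
  | nil => simp at hx
  | cons y K ih =>
    rw [halfProd_cons]
    rcases List.mem_cons.1 hx with rfl | hx'
    · rw [← mul_assoc, mul_smul_comm, mul_add, hsq x (by simp), mul_one, add_comm]
    · have hc : Commute x ((2 : ℝ)⁻¹ • (1 + y)) :=
        ((Commute.one_right x).add_right (hK x hx y (by simp))).smul_right _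
      rw [← mul_assoc, hc.eq, mul_assoc,
        ih (fun a ha b hb => hK a (by simp [ha]) b (by simp [hb]))
          (fun a ha => hsq a (by simp [ha])) hx']

theorem halfProd_mul_of_mem {K : List R} (hK : ∀ x ∈ K, ∀ y ∈ K, Commute x y)
    (hsq : ∀ x ∈ K, x * x = 1) {x : R} (hx : x ∈ K) : halfProd K * x = halfProd K := by
  rw [← (commute_halfProd fun y hy => hK x hx y hy).eq, mul_halfProd_of_mem hK hsq hx]

theorem isIdempotentElem_halfProd {K : List R} (hK : ∀ x ∈ K, ∀ y ∈ K, Commute x y)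
    (hsq : ∀ x ∈ K, x * x = 1) : IsIdempotentElem (halfProd K) := by
  -- The left list is decoupled from `K` so that the induction keeps the full product on the right,
  -- which absorbs every factor.
  have : ∀ L : List R, (∀ x ∈ L, x ∈ K) → halfProd L * halfProd K = halfProd K := by
    intro L hL
    induction L with
    | nil => simp
    | cons y L ih =>
      rw [halfProd_cons, mul_assoc, ih fun x hx => hL x (by simp [hx]), smul_mul_assoc, add_mul,
        one_mul, mul_halfProd_of_mem hK hsq (hL y (by simp)), ← two_smul ℝ, smul_smul]
      simp
  exact this K fun _ => id

end HalfProd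

/-! ### Monomials in the Clifford algebra -/

section Monomials

variable {ε : ℝ} {p q : ℕ}

theorem gen_mul_gen_of_ne {i j : Fin (p + q)} (hij : i ≠ j) :
    gen ε p q i * gen ε p q j = -(gen ε p q j * gen ε p q i) := by
  have h2 : QuadraticMap.polar (ε • sigForm p q) (Pi.single i 1) (Pi.single j 1) = 0 := by
    have h := DFunLike.congr_fun (DFunLike.congr_fun
      (QuadraticMap.two_nsmul_associated ℝ (-(ε • sigForm p q))) (Pi.single i 1)) (Pi.single j 1)
    rw [LinearMap.smul_apply, LinearMap.smul_apply, associated_single ε p q hij, smul_zero,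
      QuadraticMap.polarBilin_apply_apply, FunLike.coe_neg, QuadraticMap.polar_neg] at h
    exact neg_eq_zero.1 h.symm
  have h3 := CliffordAlgebra.ι_mul_ι_add_swap (Q := ε • sigForm p q)
    (Pi.single i 1) (Pi.single j 1)
  rw [h2, map_zero] at h3
  exact eq_neg_of_add_eq_zero_left h3

theorem signEq_gen_mul_comm (i j : Fin (p + q)) :
    SignEq (gen ε p q i * gen ε p q j) (gen ε p q j * gen ε p q i) := by
  by_cases hij : i = j
  · subst hij; exact SignEq.refl _
  · exact Or.inr (gen_mul_gen_of_ne hij)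

theorem signEq_gen_mul_self (hε : ε = 1 ∨ ε = -1) (i : Fin (p + q)) :
    SignEq (gen ε p q i * gen ε p q i) 1 := by
  rw [gen_mul_self]
  rcases hε with rfl | rfl <;> split_ifs <;> simp [SignEq]

variable (ε p q) in
/-- The product of the generators along a list of indices. -/
def listMono (l : List (Fin (p + q))) : Cl ε p q := (l.map (gen ε p q)).prod

@[simp] theorem listMono_nil : listMono ε p q [] = 1 := rfl

@[simp] theorem listMono_cons (i : Fin (p + q)) (l : List (Fin (p + q))) :
    listMono ε p q (i :: l) = gen ε p q i * listMono ε p q l := by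
  simp [listMono]

theorem listMono_append (l l' : List (Fin (p + q))) :
    listMono ε p q (l ++ l') = listMono ε p q l * listMono ε p q l' := by
  simp [listMono]

theorem mono_eq_listMono (S : Finset (Fin (p + q))) :
    mono ε p q S = listMono ε p q (S.sort (· ≤ ·)) := rfl

/-- A permutation is a composite of adjacent swaps, and each swap of generators costs at most a
sign. -/
theorem signEq_listMono_of_perm {l l' : List (Fin (p + q))} (h : l.Perm l') :
    SignEq (listMono ε p q l) (listMono ε p q l') := by
  induction h with
  | nil => exact SignEq.refl _
  | cons a _ ih => simpa using (SignEq.refl _).mul ih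
  | swap a b l =>
    simp only [listMono_cons, ← mul_assoc]
    exact (signEq_gen_mul_comm b a).mul (SignEq.refl _)
  | trans _ _ ih ih' => exact ih.trans ih'

theorem signEq_listMono_mono {l : List (Fin (p + q))} (hl : l.Nodup) :
    SignEq (listMono ε p q l) (mono ε p q l.toFinset) := by
  refine signEq_listMono_of_perm ((List.perm_ext_iff_of_nodup hl (Finset.sort_nodup _ _)).2 ?_)
  simp

theorem signEq_gen_mul_mono {i : Fin (p + q)} {S : Finset (Fin (p + q))} (hi : i ∉ S) :
    SignEq (gen ε p q i * mono ε p q S) (mono ε p q (insert i S)) := by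
  have h := signEq_listMono_mono (ε := ε) (l := i :: S.sort (· ≤ ·)) (by simp [hi])
  simpa [← mono_eq_listMono] using h

theorem signEq_gen_mul_mono_of_mem (hε : ε = 1 ∨ ε = -1) {i : Fin (p + q)}
    {S : Finset (Fin (p + q))} (hi : i ∈ S) :
    SignEq (gen ε p q i * mono ε p q S) (mono ε p q (S.erase i)) := by
  have h := (SignEq.refl (gen ε p q i)).mul
    (signEq_gen_mul_mono (ε := ε) (Finset.notMem_erase i S)).symm
  rw [Finset.insert_erase hi, ← mul_assoc] at h
  refine h.trans ?_
  simpa using (signEq_gen_mul_self hε i).mul (SignEq.refl (mono ε p q (S.erase i)))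

theorem exists_signEq_listMono (hε : ε = 1 ∨ ε = -1) {I : Set (Fin (p + q))}
    (l : List (Fin (p + q))) (hl : ∀ i ∈ l, i ∈ I) :
    ∃ S : Finset (Fin (p + q)), ↑S ⊆ I ∧ SignEq (listMono ε p q l) (mono ε p q S) := by
  induction l with
  | nil => exact ⟨∅, by simp, by simpa [mono] using SignEq.refl (1 : Cl ε p q)⟩
  | cons i l ih =>
    obtain ⟨S, hS, h⟩ := ih fun j hj => hl j (by simp [hj])
    rw [listMono_cons]
    have h' := (SignEq.refl (gen ε p q i)).mul h
    by_cases hi : i ∈ S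
    · refine ⟨S.erase i, fun j hj => hS ?_, h'.trans (signEq_gen_mul_mono_of_mem hε hi)⟩
      simp at hj ⊢
      exact hj.1
    · refine ⟨insert i S, fun j hj => ?_, h'.trans (signEq_gen_mul_mono hi)⟩
      simp only [Finset.coe_insert, Set.mem_insert_iff] at hj
      rcases hj with rfl | hj
      · exact hl j (by simp)
      · exact hS hj

theorem exists_signEq_mono_mul_mono (hε : ε = 1 ∨ ε = -1) (S T : Finset (Fin (p + q))) :
    ∃ U, SignEq (mono ε p q S * mono ε p q T) (mono ε p q U) := by
  obtain ⟨U, -, h⟩ := exists_signEq_listMono hε (I := Set.univ)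
    (S.sort (· ≤ ·) ++ T.sort (· ≤ ·)) (by simp)
  rw [listMono_append] at h
  exact ⟨U, h⟩

theorem signEq_gen_mul_listMono_comm (i : Fin (p + q)) (l : List (Fin (p + q))) :
    SignEq (gen ε p q i * listMono ε p q l) (listMono ε p q l * gen ε p q i) := by
  have := signEq_listMono_of_perm (ε := ε) (List.perm_append_comm (l₁ := [i]) (l₂ := l))
  simpa [listMono_append] using this

theorem signEq_mono_mul_comm (S T : Finset (Fin (p + q))) :
    SignEq (mono ε p q S * mono ε p q T) (mono ε p q T * mono ε p q S) := by
  have := signEq_listMono_of_perm (ε := ε)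
    (List.perm_append_comm (l₁ := S.sort (· ≤ ·)) (l₂ := T.sort (· ≤ ·)))
  rwa [listMono_append, listMono_append] at this

theorem signEq_listMono_mul_self (hε : ε = 1 ∨ ε = -1) (l : List (Fin (p + q))) :
    SignEq (listMono ε p q l * listMono ε p q l) 1 := by
  induction l with
  | nil => simpa using SignEq.refl (1 : Cl ε p q)
  | cons i l ih =>
    have h1 := ((SignEq.refl (gen ε p q i)).mul (signEq_gen_mul_listMono_comm i l).symm).mul
      (SignEq.refl (listMono ε p q l))
    have h2 := (signEq_gen_mul_self hε i).mul ih
    rw [listMono_cons]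
    simp only [mul_assoc, mul_one] at h1 h2 ⊢
    exact h1.trans h2

theorem signEq_mono_mul_self (hε : ε = 1 ∨ ε = -1) (S : Finset (Fin (p + q))) :
    SignEq (mono ε p q S * mono ε p q S) 1 :=
  signEq_listMono_mul_self hε _

theorem adjoin_gen_le_span_mono (hε : ε = 1 ∨ ε = -1) (I : Set (Fin (p + q))) {x : Cl ε p q}
    (hx : x ∈ Algebra.adjoin ℝ (gen ε p q '' I)) :
    x ∈ Submodule.span ℝ (mono ε p q '' {S | (S : Set (Fin (p + q))) ⊆ I}) := by
  rw [← Subalgebra.mem_toSubmodule, Algebra.adjoin_eq_span] at hx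
  refine Submodule.span_le.2 (fun y hy => ?_) hx
  have : ∃ l : List (Fin (p + q)), (∀ i ∈ l, i ∈ I) ∧ y = listMono ε p q l := by
    induction hy using Submonoid.closure_induction with
    | mem y hy =>
      obtain ⟨i, hi, rfl⟩ := hy
      exact ⟨[i], by simpa using hi, by simp⟩
    | one => exact ⟨[], by simp, by simp⟩
    | mul y z _ _ hy hz =>
      obtain ⟨l, hl, rfl⟩ := hy
      obtain ⟨l', hl', rfl⟩ := hz
      refine ⟨l ++ l', fun i hi => ?_, (listMono_append l l').symm⟩
      rcases List.mem_append.1 hi with h | h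
      exacts [hl i h, hl' i h]
  obtain ⟨l, hl, rfl⟩ := this
  obtain ⟨S, hS, h⟩ := exists_signEq_listMono hε l hl
  have hm : mono ε p q S ∈
      Submodule.span ℝ (mono ε p q '' {S | (S : Set (Fin (p + q))) ⊆ I}) :=
    Submodule.subset_span ⟨S, hS, rfl⟩
  rcases h with h | h
  · rw [h]; exact hm
  · rw [h]; exact Submodule.neg_mem _ hm

theorem adjoin_range_gen : Algebra.adjoin ℝ (Set.range (gen ε p q)) = ⊤ := by
  rw [← CliffordAlgebra.adjoin_range_ι, eq_comm]
  refine le_antisymm (Algebra.adjoin_le ?_) ?_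
  · rintro _ ⟨v, rfl⟩
    have hv : v = ∑ i, v i • (Pi.single i 1 : Fin (p + q) → ℝ) := by
      simpa [Pi.basisFun_apply] using ((Pi.basisFun ℝ (Fin (p + q))).sum_repr v).symm
    rw [hv, map_sum]
    refine Subalgebra.sum_mem _ fun i _ => ?_
    rw [map_smul]
    exact Subalgebra.smul_mem _ (Algebra.subset_adjoin (Set.mem_range_self i)) _
  · refine Algebra.adjoin_mono ?_
    rintro _ ⟨i, rfl⟩
    exact ⟨_, rfl⟩

theorem span_mono_eq_top (hε : ε = 1 ∨ ε = -1) :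
    Submodule.span ℝ (Set.range (mono ε p q)) = ⊤ := by
  refine top_unique fun x _ => ?_
  have hx : x ∈ Algebra.adjoin ℝ (gen ε p q '' Set.univ) := by
    rw [Set.image_univ, adjoin_range_gen]; trivial
  refine Submodule.span_mono ?_ (adjoin_gen_le_span_mono hε _ hx)
  rintro _ ⟨S, -, rfl⟩
  exact ⟨S, rfl⟩

theorem mono_mem_adjoin {I : Set (Fin (p + q))} {S : Finset (Fin (p + q))} (hS : ↑S ⊆ I) :
    mono ε p q S ∈ Algebra.adjoin ℝ (gen ε p q '' I) := by
  refine Subalgebra.list_prod_mem _ fun x hx => ?_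
  obtain ⟨i, hi, rfl⟩ := List.mem_map.1 hx
  exact Algebra.subset_adjoin ⟨i, hS (by simpa using hi), rfl⟩

/-- An even product of two generators commutes with monomials in other generators. -/
theorem commute_gen_mul_gen {a b : Fin (p + q)} {x : Cl ε p q} {I : Set (Fin (p + q))}
    (ha : a ∉ I) (hb : b ∉ I) (hx : x ∈ Algebra.adjoin ℝ (gen ε p q '' I)) :
    Commute (gen ε p q a * gen ε p q b) x := by
  induction hx using Algebra.adjoin_induction with
  | mem x hx =>
    obtain ⟨i, hi, rfl⟩ := hx
    have h1 : i ≠ a := fun h => ha (h ▸ hi)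
    have h2 : i ≠ b := fun h => hb (h ▸ hi)
    rw [commute_iff_eq, mul_assoc, gen_mul_gen_of_ne h2.symm, mul_neg, ← mul_assoc,
      gen_mul_gen_of_ne h1.symm, neg_mul, neg_neg, mul_assoc]
  | algebraMap r => exact (Algebra.commutes r _).symm
  | add x y _ _ hx hy => exact hx.add_right hy
  | mul x y _ _ hx hy => exact hx.mul_right hy

/-! ### The symbol map -/

/-- Any order of distinct generators is allowed here: the image of a sorted list under `c` need not
be sorted. -/
theorem symbol_listMono {l : List (Fin (p + q))} (hl : l.Nodup) :
    symbol ε p q (listMono ε p q l) = (l.map covec).prod := by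
  have hd : ∀ i : Fin (p + q), (Pi.basisFun ℝ (Fin (p + q))).toDual (Pi.single i 1) =
      (LinearMap.proj i : Module.Dual ℝ (Fin (p + q) → ℝ)) := by
    intro i
    refine LinearMap.ext fun v => ?_
    have h2 := (Pi.basisFun ℝ (Fin (p + q))).toDual_apply_right i v
    simpa using h2
  rw [symbol, LinearMap.comp_apply, listMono]
  erw [equivExterior_list_prod ε p q _ hl]
  rw [AlgHom.toLinearMap_apply, map_list_prod, List.map_map, List.map_map]
  congr 1
  refine List.map_congr_left fun i _ => ?_
  simp only [Function.comp_apply, ExteriorAlgebra.map_apply_ι, hd, covec]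

/-- Clifford products of elements in disjoint sets of generators are wedge products. -/
theorem equivExterior_mul_of_disjoint (hε : ε = 1 ∨ ε = -1) {I J : Set (Fin (p + q))}
    (hIJ : Disjoint I J) {x y : Cl ε p q} (hx : x ∈ Algebra.adjoin ℝ (gen ε p q '' I))
    (hy : y ∈ Algebra.adjoin ℝ (gen ε p q '' J)) :
    CliffordAlgebra.equivExterior (ε • sigForm p q) (x * y) =
      CliffordAlgebra.equivExterior (ε • sigForm p q) x *
        CliffordAlgebra.equivExterior (ε • sigForm p q) y := by
  replace hx := adjoin_gen_le_span_mono hε I hx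
  replace hy := adjoin_gen_le_span_mono hε J hy
  induction hx, hy using Submodule.span_induction₂ with
  | mem_mem x y hx hy =>
    obtain ⟨S, hS, rfl⟩ := hx
    obtain ⟨T, hT, rfl⟩ := hy
    -- Disjointness is used only here: the concatenated list has no repetition, so no contraction
    -- terms arise.
    have hnd : (S.sort (· ≤ ·) ++ T.sort (· ≤ ·)).Nodup := by
      refine (List.nodup_append').2 ⟨Finset.sort_nodup _ _, Finset.sort_nodup _ _, ?_⟩
      intro i hi hi'
      exact Set.disjoint_left.1 hIJ (hS (by simpa using hi)) (hT (by simpa using hi'))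
    have h := equivExterior_list_prod ε p q _ hnd
    rw [List.map_append, List.map_append, List.map_append, List.prod_append, List.prod_append,
      ← equivExterior_list_prod ε p q _ (Finset.sort_nodup _ _),
      ← equivExterior_list_prod ε p q _ (Finset.sort_nodup _ _)] at h
    exact h
  | zero_left y _ => simp
  | zero_right x _ => simp
  | add_left x y z _ _ _ hx hy => simp only [add_mul, map_add, hx, hy]
  | add_right x y z _ _ _ hx hy => simp only [mul_add, map_add, hx, hy]
  | smul_left r x y _ _ h => simp only [smul_mul_assoc, map_smul, h]
  | smul_right r x y _ _ h => simp only [mul_smul_comm, map_smul, h]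

variable (p q) in
/-- The identification `e_i ↦ e^i` of exterior algebras. -/
def toForm : ExteriorAlgebra ℝ (Fin (p + q) → ℝ) →ₐ[ℝ] Form (p + q) :=
  ExteriorAlgebra.map (Pi.basisFun ℝ (Fin (p + q))).toDual

theorem symbol_apply (x : Cl ε p q) :
    symbol ε p q x = toForm p q (CliffordAlgebra.equivExterior (ε • sigForm p q) x) := rfl

theorem symbol_mul_of_disjoint (hε : ε = 1 ∨ ε = -1) {I J : Set (Fin (p + q))}
    (hIJ : Disjoint I J) {x y : Cl ε p q} (hx : x ∈ Algebra.adjoin ℝ (gen ε p q '' I))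
    (hy : y ∈ Algebra.adjoin ℝ (gen ε p q '' J)) :
    symbol ε p q (x * y) = symbol ε p q x * symbol ε p q y := by
  rw [symbol_apply, equivExterior_mul_of_disjoint hε hIJ hx hy, map_mul]; rfl

theorem symbol_bijective : Function.Bijective (symbol ε p q) := by
  have h1 : Function.Bijective (toForm p q) := by
    refine Function.bijective_iff_has_inverse.2
      ⟨ExteriorAlgebra.map (Pi.basisFun ℝ (Fin (p + q))).toDualEquiv.symm.toLinearMap, ?_, ?_⟩
    · intro x
      have : (ExteriorAlgebra.map
          (Pi.basisFun ℝ (Fin (p + q))).toDualEquiv.symm.toLinearMap).comp (toForm p q) =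
          AlgHom.id ℝ _ := by
        rw [toForm, ExteriorAlgebra.map_comp_map, ← ExteriorAlgebra.map_id]
        congr 1
        refine LinearMap.ext fun v => ?_
        exact (Pi.basisFun ℝ (Fin (p + q))).toDualEquiv.symm_apply_apply _
      exact DFunLike.congr_fun this x
    · intro x
      have : (toForm p q).comp (ExteriorAlgebra.map
          (Pi.basisFun ℝ (Fin (p + q))).toDualEquiv.symm.toLinearMap) = AlgHom.id ℝ _ := by
        rw [toForm, ExteriorAlgebra.map_comp_map, ← ExteriorAlgebra.map_id]
        congr 1
        refine LinearMap.ext fun v => ?_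
        exact (Pi.basisFun ℝ (Fin (p + q))).toDualEquiv.apply_symm_apply _
      exact DFunLike.congr_fun this x
  exact h1.comp (CliffordAlgebra.equivExterior (ε • sigForm p q)).bijective

theorem pull_injective {n N : ℕ} (c : Fin n ↪ Fin N) : Function.Injective (pull c) := by
  refine ExteriorAlgebra.map_injective_field ?_
  refine LinearMap.ker_eq_bot.2 (LinearMap.dualMap_injective_of_surjective ?_)
  exact LinearMap.funLeft_surjective_of_injective ℝ ℝ c c.injective

end Monomials

/-! ### The Kähler polynomial as a product -/

/-- For commuting elements of square zero, `∏ (1 + w)` is the truncated exponential of `∑ w`. -/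
theorem prod_one_add_eq_sum_pow {A : Type*} [Ring A] [Algebra ℝ A] (W : List A)
    (hW : ∀ x ∈ W, ∀ y ∈ W, Commute x y) (h0 : ∀ x ∈ W, x * x = 0) :
    (W.map fun x => 1 + x).prod =
      ∑ k ∈ Finset.range (W.length + 1), ((k.factorial : ℝ)⁻¹) • W.sum ^ k ∧
    W.sum ^ (W.length + 1) = 0 := by
  induction W with
  | nil => simp
  | cons w W ih =>
    obtain ⟨ih1, ih2⟩ := ih (fun x hx y hy => hW x (by simp [hx]) y (by simp [hy]))
      (fun x hx => h0 x (by simp [hx]))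
    have hc : Commute w W.sum :=
      Commute.list_sum_right _ _ fun x hx => hW w (by simp) x (by simp [hx])
    have hw : w * w = 0 := h0 w (by simp)
    -- The binomial expansion stops at the linear term in `w`, since `w * w = 0`.
    have hpow : ∀ k : ℕ, (w + W.sum) ^ (k + 1) =
        W.sum ^ (k + 1) + ((k : ℝ) + 1) • (w * W.sum ^ k) := by
      intro k
      induction k with
      | zero => simp [add_comm]
      | succ k ihk =>
        have e1 : w * W.sum ^ k * w = 0 := by
          rw [mul_assoc, ← (hc.pow_right k).eq, ← mul_assoc, hw, zero_mul]
        have e2 : W.sum ^ (k + 1) * w = w * W.sum ^ (k + 1) := ((hc.pow_right (k + 1)).eq).symm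
        rw [pow_succ, ihk, add_mul, mul_add, mul_add, smul_mul_assoc, smul_mul_assoc, e1, e2,
          mul_assoc, ← pow_succ, ← pow_succ]
        push_cast
        module
    rw [List.map_cons, List.prod_cons, List.sum_cons, List.length_cons]
    constructor
    · rw [Finset.sum_range_succ' _ (W.length + 1)]
      have hterm : ∀ k : ℕ, (((k + 1).factorial : ℝ)⁻¹) • (w + W.sum) ^ (k + 1) =
          (((k + 1).factorial : ℝ)⁻¹) • W.sum ^ (k + 1) +
            w * (((k.factorial : ℝ)⁻¹) • W.sum ^ k) := by
        intro k
        rw [hpow, smul_add, smul_smul, mul_smul_comm, Nat.factorial_succ]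
        congr 2
        have : (k.factorial : ℝ) ≠ 0 := by positivity
        push_cast
        field_simp
      simp only [hterm, Finset.sum_add_distrib]
      rw [← Finset.mul_sum, ← ih1, add_mul, one_mul, add_right_comm]
      congr 1
      -- The extra top power of the shorter sum vanishes; the nilpotency clause is carried through
      -- the induction for this.
      rw [Finset.sum_range_succ, ih2, smul_zero, add_zero, ih1, Finset.sum_range_succ']
      simp
    · rw [hpow, pow_succ, ih2]
      simp

/-! ### The element `∏ (1 + s_j)` -/

section Pairs

variable {ε : ℝ} {p q m : ℕ}

variable (ε) in
/-- The bivector `e_{c j} e_{c (m + j)}`. -/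
def pairGen (c : Fin (m + m) ↪ Fin (p + q)) (j : Fin m) : Cl ε p q :=
  gen ε p q (c (Fin.castAdd m j)) * gen ε p q (c (Fin.natAdd m j))

variable (p q) in
/-- The `i`-th unit vector in the exterior algebra. -/
def extGen (i : Fin (p + q)) : ExteriorAlgebra ℝ (Fin (p + q) → ℝ) :=
  ExteriorAlgebra.ι ℝ (Pi.single i 1)

/-- The bivector `e_{c j} ∧ e_{c (m + j)}`. -/
def pairExt (c : Fin (m + m) ↪ Fin (p + q)) (j : Fin m) : ExteriorAlgebra ℝ (Fin (p + q) → ℝ) :=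
  extGen p q (c (Fin.castAdd m j)) * extGen p q (c (Fin.natAdd m j))

theorem castAdd_ne_natAdd (i j : Fin m) : Fin.castAdd m i ≠ Fin.natAdd m j := by
  intro h
  have := congrArg Fin.val h
  simp at this
  omega

theorem equivExterior_pairGen (c : Fin (m + m) ↪ Fin (p + q)) (j : Fin m) :
    CliffordAlgebra.equivExterior (ε • sigForm p q) (pairGen ε c j) = pairExt c j := by
  have hnd : [c (Fin.castAdd m j), c (Fin.natAdd m j)].Nodup := by
    simpa using fun h => castAdd_ne_natAdd j j (c.injective h)
  have h := equivExterior_list_prod ε p q _ hnd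
  simpa [pairGen, pairExt, extGen] using h

theorem commute_extGen_mul (a b : Fin (p + q)) (v : Fin (p + q) → ℝ) :
    Commute (extGen p q a * extGen p q b) (ExteriorAlgebra.ι ℝ v) := by
  have h : ∀ x y : Fin (p + q) → ℝ, ExteriorAlgebra.ι ℝ x * ExteriorAlgebra.ι ℝ y =
      -(ExteriorAlgebra.ι ℝ y * ExteriorAlgebra.ι ℝ x) := fun x y =>
    eq_neg_of_add_eq_zero_left (ExteriorAlgebra.ι_add_mul_swap x y)
  rw [extGen, extGen, commute_iff_eq, mul_assoc, h _ v, mul_neg, ← mul_assoc, h _ v, neg_mul,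
    neg_neg, mul_assoc]

theorem commute_pairExt (c : Fin (m + m) ↪ Fin (p + q)) (i j : Fin m) :
    Commute (pairExt c i) (pairExt c j) :=
  (commute_extGen_mul _ _ _).mul_right (commute_extGen_mul _ _ _)

theorem pairExt_mul_self (c : Fin (m + m) ↪ Fin (p + q)) (i : Fin m) :
    pairExt c i * pairExt c i = 0 := by
  have h : extGen p q (c (Fin.castAdd m i)) * extGen p q (c (Fin.castAdd m i)) = 0 :=
    ExteriorAlgebra.ι_sq_zero _
  have h' : Commute (pairExt c i) (extGen p q (c (Fin.castAdd m i))) := commute_extGen_mul _ _ _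
  nth_rw 2 [pairExt]
  rw [← mul_assoc, h'.eq, pairExt,
    ← mul_assoc (extGen p q _), h]
  simp

variable (ε) in
/-- The product of the `1 + e_{c j} e_{c (m + j)}`. -/
def pairProd (c : Fin (m + m) ↪ Fin (p + q)) : Cl ε p q :=
  (List.ofFn fun j => 1 + pairGen ε c j).prod

theorem pairGen_mem (c : Fin (m + m) ↪ Fin (p + q)) (j : Fin m) {I : Set (Fin (p + q))}
    (h1 : c (Fin.castAdd m j) ∈ I) (h2 : c (Fin.natAdd m j) ∈ I) :
    pairGen ε c j ∈ Algebra.adjoin ℝ (gen ε p q '' I) :=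
  Subalgebra.mul_mem _ (Algebra.subset_adjoin ⟨_, h1, rfl⟩) (Algebra.subset_adjoin ⟨_, h2, rfl⟩)

/-- Distinct indices use disjoint pairs of generators, so the factors can be turned into exterior
factors one at a time. -/
theorem equivExterior_prod_one_add (hε : ε = 1 ∨ ε = -1) (c : Fin (m + m) ↪ Fin (p + q))
    (l : List (Fin m)) (hl : l.Nodup) :
    CliffordAlgebra.equivExterior (ε • sigForm p q) (l.map fun j => 1 + pairGen ε c j).prod =
      (l.map fun j => 1 + pairExt c j).prod := by
  have h1 : CliffordAlgebra.equivExterior (ε • sigForm p q) 1 = 1 := by simp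
  induction l with
  | nil => simp
  | cons j l ih =>
    have hj : j ∉ l := (List.nodup_cons.1 hl).1
    rw [List.map_cons, List.map_cons, List.prod_cons, List.prod_cons, ← ih hl.of_cons,
      ← equivExterior_pairGen (ε := ε), ← h1, ← map_add]
    refine equivExterior_mul_of_disjoint hε
      (I := {c (Fin.castAdd m j), c (Fin.natAdd m j)})
      (J := {x | ∃ i ∈ l, x = c (Fin.castAdd m i) ∨ x = c (Fin.natAdd m i)}) ?_ ?_ ?_
    · rw [Set.disjoint_left]
      rintro x hx ⟨i, hi, hx'⟩
      have hij : i ≠ j := fun h => hj (h ▸ hi)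
      rcases hx with rfl | rfl <;> rcases hx' with hx' | hx' <;> replace hx' := c.injective hx'
      · exact hij (Fin.castAdd_injective m m hx').symm
      · exact castAdd_ne_natAdd _ _ hx'
      · exact castAdd_ne_natAdd _ _ hx'.symm
      · exact hij (Fin.natAdd_injective m m hx').symm
    · exact Subalgebra.add_mem _ (Subalgebra.one_mem _) (pairGen_mem c j (by simp) (by simp))
    · refine Subalgebra.list_prod_mem _ fun x hx => ?_
      obtain ⟨i, hi, rfl⟩ := List.mem_map.1 hx
      exact Subalgebra.add_mem _ (Subalgebra.one_mem _)
        (pairGen_mem c i ⟨i, hi, Or.inl rfl⟩ ⟨i, hi, Or.inr rfl⟩)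

theorem equivExterior_pairProd (hε : ε = 1 ∨ ε = -1) (c : Fin (m + m) ↪ Fin (p + q)) :
    CliffordAlgebra.equivExterior (ε • sigForm p q) (pairProd ε c) =
      ∑ k ∈ Finset.range (m + 1), ((k.factorial : ℝ)⁻¹) • (∑ j, pairExt c j) ^ k := by
  rw [pairProd, List.ofFn_eq_map, equivExterior_prod_one_add hε c _ (List.nodup_finRange m)]
  have h := (prod_one_add_eq_sum_pow ((List.finRange m).map (pairExt c)) ?_ ?_).1
  · rw [List.map_map, ← List.ofFn_eq_map (f := pairExt c), List.sum_ofFn, List.length_ofFn] at h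
    exact h
  · simp [commute_pairExt]
  · simp [pairExt_mul_self]

/-- The truncated exponential has scalar part `1`. -/
theorem pairProd_ne_zero (hε : ε = 1 ∨ ε = -1) (c : Fin (m + m) ↪ Fin (p + q)) :
    pairProd ε c ≠ 0 := by
  intro h
  have h1 := equivExterior_pairProd hε c
  rw [h, map_zero] at h1
  have h2 := congrArg ExteriorAlgebra.algebraMapInv h1
  have h3 : ExteriorAlgebra.algebraMapInv (∑ j, pairExt c j) = 0 := by
    simp [pairExt, extGen, ExteriorAlgebra.algebraMapInv]
  rw [map_zero, map_sum, Finset.sum_range_succ'] at h2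
  simp only [map_smul, map_pow, h3] at h2
  simp at h2

theorem toForm_pairExt (c : Fin (m + m) ↪ Fin (p + q)) :
    toForm p q (∑ j, pairExt c j) = pull c (stdKahler m) := by
  have h : ∀ i, toForm p q (extGen p q i) = covec i := by
    intro i
    rw [toForm, extGen, ExteriorAlgebra.map_apply_ι, covec]
    congr 1
    refine LinearMap.ext fun v => ?_
    have h2 := (Pi.basisFun ℝ (Fin (p + q))).toDual_apply_right i v
    simpa using h2
  simp only [stdKahler, map_sum, map_mul, pull_covec, pairExt, h]

theorem symbol_pairProd (hε : ε = 1 ∨ ε = -1) (c : Fin (m + m) ↪ Fin (p + q)) :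
    symbol ε p q (pairProd ε c) = kahlerPoly m (pull c (stdKahler m)) := by
  rw [symbol_apply, equivExterior_pairProd hε, map_sum, kahlerPoly]
  simp only [map_smul, map_pow, toForm_pairExt]

theorem pairExt_mem (c : Fin (m + m) ↪ Fin (p + q)) :
    ∑ j, pairExt c j ∈ ⋀[ℝ]^2 (Fin (p + q) → ℝ) := by
  refine Submodule.sum_mem _ fun k _ => ?_
  change _ ∈ LinearMap.range (ExteriorAlgebra.ι ℝ) ^ 2
  rw [pow_two]
  exact Submodule.mul_mem_mul (LinearMap.mem_range_self _ _) (LinearMap.mem_range_self _ _)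

theorem gradePart_pairProd (hε : ε = 1 ∨ ε = -1) (c : Fin (m + m) ↪ Fin (p + q)) :
    gradePart ε p q 2 (pairProd ε c) = ∑ j, pairGen ε c j := by
  rw [gradePart, LinearEquiv.symm_apply_eq, equivExterior_pairProd hε, map_sum, map_sum]
  simp only [equivExterior_pairGen]
  -- The `k`-th power of a bivector has degree `2k`, so degree two keeps only `k = 1`.
  have hproj : ∀ k : ℕ, GradedRing.proj (fun i : ℕ => ⋀[ℝ]^i (Fin (p + q) → ℝ)) 2
      (((k.factorial : ℝ)⁻¹) • (∑ j, pairExt c j) ^ k) =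
        if k = 1 then ∑ j, pairExt c j else 0 := by
    intro k
    have hmem : (((k.factorial : ℝ)⁻¹) • (∑ j, pairExt c j) ^ k) ∈
        ⋀[ℝ]^(k • 2) (Fin (p + q) → ℝ) :=
      Submodule.smul_mem _ _ (SetLike.pow_mem_graded (A := fun i : ℕ => ⋀[ℝ]^i (Fin (p + q) → ℝ))
        k (pairExt_mem c))
    rw [GradedRing.proj_apply]
    split_ifs with hk
    · subst hk
      rw [DirectSum.decompose_of_mem_same _ (by simpa using hmem)]
      simp
    · exact DirectSum.decompose_of_mem_ne _ hmem (by simp; omega)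
  rw [Finset.sum_congr rfl fun k _ => hproj k, Finset.sum_ite_eq']
  -- For `m = 0` the index `1` is out of range, but the sum of bivectors is then empty too.
  rcases Nat.eq_zero_or_pos m with rfl | hm
  · simp
  · simp [hm]

theorem symbol_gradePart_pairProd (hε : ε = 1 ∨ ε = -1) (c : Fin (m + m) ↪ Fin (p + q)) :
    symbol ε p q (gradePart ε p q 2 (pairProd ε c)) = pull c (stdKahler m) := by
  rw [gradePart_pairProd hε, symbol_apply, map_sum, ← toForm_pairExt]
  simp only [equivExterior_pairGen]

/-! ### Coordinate subalgebras -/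

/-- The isometric inclusion of coordinates `v ↦ ∑ v_k e_{c k}`. -/
def coordIsometry (ε : ℝ) (c : Fin (m + m) ↪ Fin (p + q))
    (hc : ∀ k, (c k : ℕ) < p ↔ (k : ℕ) < m) : (ε • sigForm m m) →qᵢ (ε • sigForm p q) where
  toLinearMap := Function.ExtendByZero.linearMap ℝ c
  map_app' v := by
    simp only [AddHom.toFun_eq_coe, LinearMap.coe_toAddHom, FunLike.coe_smul, Pi.smul_apply,
      sigForm, QuadraticMap.weightedSumSquares_apply, Function.ExtendByZero.linearMap_apply]
    congr 1
    symm
    refine Finset.sum_of_injOn c c.injective.injOn (by simp) ?_ ?_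
    · intro i _ hi
      rw [Function.extend_apply']
      · simp
      · rintro ⟨k, rfl⟩
        simp at hi
    · intro k _
      rw [c.injective.extend_apply]
      simp only [hc]

/-- The homomorphism of Clifford algebras with `e_k ↦ e_{c k}`. -/
def coordHom (ε : ℝ) (c : Fin (m + m) ↪ Fin (p + q))
    (hc : ∀ k, (c k : ℕ) < p ↔ (k : ℕ) < m) : Cl ε m m →ₐ[ℝ] Cl ε p q :=
  CliffordAlgebra.map (coordIsometry ε c hc)

theorem coordHom_gen (c : Fin (m + m) ↪ Fin (p + q))
    (hc : ∀ k, (c k : ℕ) < p ↔ (k : ℕ) < m) (k : Fin (m + m)) :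
    coordHom ε c hc (gen ε m m k) = gen ε p q (c k) := by
  rw [coordHom, gen, CliffordAlgebra.map_apply_ι, gen]
  congr 1
  change Function.extend c (Pi.single k 1) 0 = _
  funext i
  by_cases hi : ∃ l, c l = i
  · obtain ⟨l, rfl⟩ := hi
    rw [c.injective.extend_apply]
    simp [Pi.single_apply]
  · rw [Function.extend_apply' _ _ _ hi]
    rw [Pi.single_eq_of_ne]
    · rfl
    · rintro rfl
      exact hi ⟨k, rfl⟩

theorem symbol_coordHom (hε : ε = 1 ∨ ε = -1) (c : Fin (m + m) ↪ Fin (p + q))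
    (hc : ∀ k, (c k : ℕ) < p ↔ (k : ℕ) < m) (x : Cl ε m m) :
    symbol ε p q (coordHom ε c hc x) = pull c (symbol ε m m x) := by
  have hx : x ∈ Submodule.span ℝ (Set.range (mono ε m m)) := by
    rw [span_mono_eq_top hε]; trivial
  induction hx using Submodule.span_induction with
  | mem x hx =>
    obtain ⟨S, rfl⟩ := hx
    have h1 : coordHom ε c hc (mono ε m m S) =
        listMono ε p q ((S.sort (· ≤ ·)).map c) := by
      rw [mono, map_list_prod, listMono, List.map_map, List.map_map]
      simp only [Function.comp_def, coordHom_gen]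
    rw [h1, symbol_listMono ((Finset.sort_nodup _ _).map c.injective), symbol_mono,
      map_list_prod, List.map_map, List.map_map]
    simp only [Function.comp_def, pull_covec]
  | zero => simp
  | add x y _ _ hx hy => simp only [map_add, hx, hy]
  | smul r x _ hx => simp only [map_smul, hx]

/-- Symbols turn the map into the injective pullback of forms, so no dimension count is needed. -/
theorem coordHom_injective (hε : ε = 1 ∨ ε = -1) (c : Fin (m + m) ↪ Fin (p + q))
    (hc : ∀ k, (c k : ℕ) < p ↔ (k : ℕ) < m) : Function.Injective (coordHom ε c hc) := by
  intro x y hxy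
  have h := congrArg (symbol ε p q) hxy
  rw [symbol_coordHom hε, symbol_coordHom hε] at h
  exact symbol_bijective.1 (pull_injective c h)

theorem range_coordHom (c : Fin (m + m) ↪ Fin (p + q))
    (hc : ∀ k, (c k : ℕ) < p ↔ (k : ℕ) < m) :
    (coordHom ε c hc).range = coordSubalgebra ε p q c := by
  rw [← Algebra.map_top, ← adjoin_range_gen, AlgHom.map_adjoin, ← Set.range_comp, coordSubalgebra]
  simp only [Function.comp_def, coordHom_gen]

/-- `e_k ↦ e_{c k}` as an isomorphism onto the coordinate subalgebra. -/
def coordEquiv (hε : ε = 1 ∨ ε = -1) (c : Fin (m + m) ↪ Fin (p + q))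
    (hc : ∀ k, (c k : ℕ) < p ↔ (k : ℕ) < m) : Cl ε m m ≃ₐ[ℝ] coordSubalgebra ε p q c :=
  (AlgEquiv.ofInjective _ (coordHom_injective hε c hc)).trans
    (Subalgebra.equivOfEq _ _ (range_coordHom c hc))

theorem coe_coordEquiv (hε : ε = 1 ∨ ε = -1) (c : Fin (m + m) ↪ Fin (p + q))
    (hc : ∀ k, (c k : ℕ) < p ↔ (k : ℕ) < m) (x : Cl ε m m) :
    (coordEquiv hε c hc x : Cl ε p q) = coordHom ε c hc x := rfl

theorem pairGen_mem_coordSubalgebra (c : Fin (m + m) ↪ Fin (p + q)) (j : Fin m) :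
    pairGen ε c j ∈ coordSubalgebra ε p q c :=
  Subalgebra.mul_mem _ (Algebra.subset_adjoin ⟨_, rfl⟩) (Algebra.subset_adjoin ⟨_, rfl⟩)

theorem pairProd_mem_coordSubalgebra (c : Fin (m + m) ↪ Fin (p + q)) :
    pairProd ε c ∈ coordSubalgebra ε p q c := by
  refine Subalgebra.list_prod_mem _ fun x hx => ?_
  obtain ⟨j, rfl⟩ := List.mem_ofFn.1 hx
  exact Subalgebra.add_mem _ (Subalgebra.one_mem _) (pairGen_mem_coordSubalgebra c j)

theorem recoversByProjection_pairProd (hε : ε = 1 ∨ ε = -1) (c : Fin (m + m) ↪ Fin (p + q))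
    (hc : ∀ k, (c k : ℕ) < p ↔ (k : ℕ) < m) (hlt : m + m < p + q) :
    RecoversByProjection ε p q c (pairProd ε c) (stdUnitary m) where
  dim_lt := hlt
  mem := pairProd_mem_coordSubalgebra c
  iso := ⟨coordEquiv hε c hc, fun k => by rw [coe_coordEquiv, coordHom_gen]⟩
  recovers := by
    have hτ : ∀ a : coordSubalgebra ε p q c,
        pull c (symbol ε m m ((coordEquiv hε c hc).symm a)) = symbol ε p q (a : Cl ε p q) := by
      intro a
      rw [← symbol_coordHom hε c hc, ← coe_coordEquiv hε c hc, AlgEquiv.apply_symm_apply]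
    -- The isomorphism `τ` is the symbol map of `ℝ_{m,m}` transported along `coordEquiv`, and `ψ` is
    -- the degree two part.
    refine ⟨(coordEquiv hε c hc).symm.toLinearEquiv.trans
      (LinearEquiv.ofBijective (symbol ε m m) symbol_bijective), hτ,
      ⟨gradePart ε p q 2 (pairProd ε c), ?_⟩, Algebra.subset_adjoin ⟨2, rfl⟩, ?_⟩
    · rw [gradePart_pairProd hε]
      exact Subalgebra.sum_mem _ fun j _ => pairGen_mem_coordSubalgebra c j
    · refine pull_injective c ((hτ _).trans ?_)
      exact symbol_gradePart_pairProd hε c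

end Pairs

/-! ### Primitive idempotents from maximal sets of commuting monomials -/

section PrimitiveMonomials

variable {ε : ℝ} {p q m : ℕ}

theorem self_eq_neg_real {R : Type*} [Ring R] [Algebra ℝ R] {x : R} (h : x = -x) : x = 0 := by
  have h2 : (2 : ℝ) • x = 0 := by rw [two_smul]; nth_rw 1 [h]; exact neg_add_cancel x
  exact (smul_eq_zero_iff_right two_ne_zero).1 h2

theorem mono_ne_zero (hε : ε = 1 ∨ ε = -1) (S : Finset (Fin (p + q))) : mono ε p q S ≠ 0 := by
  intro h
  have h1 := signEq_mono_mul_self hε S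
  rw [h] at h1
  rcases h1 with h1 | h1 <;> simp at h1

theorem commute_pairGen (c : Fin (m + m) ↪ Fin (p + q)) (i j : Fin m) :
    Commute (pairGen ε c i) (pairGen ε c j) := by
  by_cases hij : i = j
  · subst hij; exact Commute.refl _
  · refine commute_gen_mul_gen (I := {c (Fin.castAdd m j), c (Fin.natAdd m j)}) ?_ ?_
      (pairGen_mem c j (by simp) (by simp))
    · rintro (h | h) <;> replace h := c.injective h
      · exact hij (Fin.castAdd_injective m m h)
      · exact castAdd_ne_natAdd _ _ h
    · rintro (h | h) <;> replace h := c.injective h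
      · exact castAdd_ne_natAdd _ _ h.symm
      · exact hij (Fin.natAdd_injective m m h)

theorem pairGen_mul_self (hε : ε = 1 ∨ ε = -1) (c : Fin (m + m) ↪ Fin (p + q))
    (hc : ∀ k, (c k : ℕ) < p ↔ (k : ℕ) < m) (j : Fin m) :
    pairGen ε c j * pairGen ε c j = 1 := by
  have hne : c (Fin.natAdd m j) ≠ c (Fin.castAdd m j) := fun h =>
    castAdd_ne_natAdd j j (c.injective h).symm
  have h1 : (c (Fin.castAdd m j) : ℕ) < p := (hc _).2 (by simp)
  have h2 : ¬ (c (Fin.natAdd m j) : ℕ) < p := fun h => by simpa using (hc _).1 h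
  have e1 := gen_mul_self ε p q (c (Fin.castAdd m j))
  have e2 := gen_mul_self ε p q (c (Fin.natAdd m j))
  rw [if_pos h1] at e1
  rw [if_neg h2] at e2
  rw [pairGen, mul_assoc, ← mul_assoc (gen ε p q (c (Fin.natAdd m j))), gen_mul_gen_of_ne hne,
    neg_mul, mul_neg, mul_assoc, ← mul_assoc, e1, e2, ← map_mul]
  rcases hε with rfl | rfl <;> simp

/-- Splitting `e_a` off `e_S`, the bivector commutes with the rest and anticommutes with `e_a`. -/
theorem gen_mul_gen_anticommute_mono {a b : Fin (p + q)} (hab : a ≠ b)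
    {S : Finset (Fin (p + q))} (ha : a ∈ S) (hb : b ∉ S) :
    gen ε p q a * gen ε p q b * mono ε p q S = -(mono ε p q S * (gen ε p q a * gen ε p q b)) := by
  have hc : Commute (gen ε p q a * gen ε p q b) (mono ε p q (S.erase a)) :=
    commute_gen_mul_gen (I := ↑(S.erase a)) (by simp) (by simp [hb]) (mono_mem_adjoin le_rfl)
  have hx : gen ε p q a * gen ε p q b * gen ε p q a =
      -(gen ε p q a * (gen ε p q a * gen ε p q b)) := by
    rw [mul_assoc, gen_mul_gen_of_ne hab.symm, mul_neg]
  have key : gen ε p q a * gen ε p q b * (gen ε p q a * mono ε p q (S.erase a)) =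
      -(gen ε p q a * mono ε p q (S.erase a) * (gen ε p q a * gen ε p q b)) := by
    rw [← mul_assoc, hx, neg_mul, mul_assoc, hc.eq, ← mul_assoc]
  have hS := signEq_gen_mul_mono (ε := ε) (Finset.notMem_erase a S)
  rw [Finset.insert_erase ha] at hS
  rcases hS.symm with h | h <;> rw [h]
  · exact key
  · rw [mul_neg, key, neg_mul]

/-- If `S` contained exactly one of the two indices, bivector and monomial would also anticommute,
so their product would vanish; but the bivector is invertible and the monomial is nonzero. -/
theorem mem_iff_mem_of_commute_pairGen (hε : ε = 1 ∨ ε = -1) (c : Fin (m + m) ↪ Fin (p + q))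
    (hc : ∀ k, (c k : ℕ) < p ↔ (k : ℕ) < m) {S : Finset (Fin (p + q))} {j : Fin m}
    (h : Commute (pairGen ε c j) (mono ε p q S)) :
    c (Fin.castAdd m j) ∈ S ↔ c (Fin.natAdd m j) ∈ S := by
  have hne : c (Fin.castAdd m j) ≠ c (Fin.natAdd m j) := fun h =>
    castAdd_ne_natAdd j j (c.injective h)
  have hnot : pairGen ε c j * mono ε p q S ≠ -(mono ε p q S * pairGen ε c j) := by
    intro h1
    rw [← h.eq] at h1
    have h2 := congrArg (pairGen ε c j * ·) (self_eq_neg_real h1)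
    simp only [← mul_assoc, pairGen_mul_self hε c hc, one_mul, mul_zero] at h2
    exact mono_ne_zero hε S h2
  by_contra hcon
  by_cases ha : c (Fin.castAdd m j) ∈ S
  · have hb : c (Fin.natAdd m j) ∉ S := fun hb => hcon (iff_of_true ha hb)
    exact hnot (gen_mul_gen_anticommute_mono hne ha hb)
  · have hb : c (Fin.natAdd m j) ∈ S := by
      by_contra hb
      exact hcon (iff_of_false ha hb)
    refine hnot ?_
    rw [pairGen, gen_mul_gen_of_ne hne, neg_mul, mul_neg,
      gen_mul_gen_anticommute_mono hne.symm hb ha]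

/-- A monomial that commutes with all `e_{c j} e_{c (m + j)}` is, up to sign, a product of some of
them and of a monomial in the complementary generators. -/
theorem exists_signEq_mul_mono_compl (hε : ε = 1 ∨ ε = -1) (c : Fin (m + m) ↪ Fin (p + q))
    (hc : ∀ k, (c k : ℕ) < p ↔ (k : ℕ) < m) (S : Finset (Fin (p + q)))
    (hS : ∀ j, Commute (pairGen ε c j) (mono ε p q S)) :
    ∃ u ∈ Submonoid.closure (Set.range (pairGen ε c)), ∃ T : Finset (Fin (p + q)),
      (T : Set (Fin (p + q))) ⊆ (Set.range c)ᶜ ∧ SignEq (mono ε p q S) (u * mono ε p q T) := by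
  induction hn : S.card using Nat.strong_induction_on generalizing S with
  | _ n ih =>
  by_cases hD : (S : Set (Fin (p + q))) ⊆ (Set.range c)ᶜ
  · exact ⟨1, one_mem _, S, hD, by rw [one_mul]; exact SignEq.refl _⟩
  have hex : ∃ j : Fin m, c (Fin.castAdd m j) ∈ S := by
    rw [Set.not_subset] at hD
    obtain ⟨_, hk, hk'⟩ := hD
    obtain ⟨k, rfl⟩ := not_not.1 hk'
    induction k using Fin.addCases with
    | left j => exact ⟨j, hk⟩
    | right j => exact ⟨j, (mem_iff_mem_of_commute_pairGen hε c hc (hS j)).2 hk⟩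
  obtain ⟨j, ha⟩ := hex
  have hb := (mem_iff_mem_of_commute_pairGen hε c hc (hS j)).1 ha
  have hne : c (Fin.castAdd m j) ≠ c (Fin.natAdd m j) := fun h =>
    castAdd_ne_natAdd j j (c.injective h)
  set a := c (Fin.castAdd m j) with ha'
  set b := c (Fin.natAdd m j) with hb'
  have hbe : b ∈ S.erase a := Finset.mem_erase.2 ⟨hne.symm, hb⟩
  have h1 := signEq_gen_mul_mono (ε := ε) (Finset.notMem_erase a S)
  have h2 := signEq_gen_mul_mono (ε := ε) (Finset.notMem_erase b (S.erase a))
  rw [Finset.insert_erase ha] at h1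
  rw [Finset.insert_erase hbe] at h2
  have h3 : SignEq (mono ε p q S) (pairGen ε c j * mono ε p q ((S.erase a).erase b)) := by
    rw [pairGen, mul_assoc]
    exact h1.symm.trans ((SignEq.refl _).mul h2.symm)
  -- The monomial with the pair removed is `± s_j e_S`, so it still commutes with every `s_i` and
  -- the induction on cardinality continues.
  have h4 : SignEq (pairGen ε c j * mono ε p q S) (mono ε p q ((S.erase a).erase b)) := by
    have := (SignEq.refl (pairGen ε c j)).mul h3
    rwa [← mul_assoc, pairGen_mul_self hε c hc, one_mul] at this
  obtain ⟨u, hu, T, hT, hTS⟩ := ih _ (by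
    rw [← hn]
    exact (Finset.card_erase_lt_of_mem hbe).trans (Finset.card_erase_lt_of_mem ha))
    ((S.erase a).erase b)
    (fun i => (h4.commute_left ((commute_pairGen c i j).mul_right (hS i)).symm).symm) rfl
  refine ⟨pairGen ε c j * u, mul_mem (Submonoid.subset_closure ⟨j, rfl⟩) hu, T, hT, ?_⟩
  rw [mul_assoc]
  exact h3.trans ((SignEq.refl _).mul hTS)

/-! ### Maximal families of commuting monomials -/

variable (ε) in
/-- The list of the `e_{c j} e_{c (m + j)}`, followed by the monomials of `L`. -/
def involutions (c : Fin (m + m) ↪ Fin (p + q)) (L : List (Finset (Fin (p + q)))) :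
    List (Cl ε p q) :=
  List.ofFn (pairGen ε c) ++ L.map (mono ε p q)

variable (ε) in
/-- Distinct commuting monomials of square `1` in the generators complementary to `c`, for which
the product of the idempotents does not vanish. -/
structure IsAdmissible (c : Fin (m + m) ↪ Fin (p + q)) (L : List (Finset (Fin (p + q)))) :
    Prop where
  nodup : L.Nodup
  subset : ∀ α ∈ L, (α : Set (Fin (p + q))) ⊆ (Set.range c)ᶜ
  sq : ∀ α ∈ L, mono ε p q α * mono ε p q α = 1
  comm : ∀ α ∈ L, ∀ β ∈ L, Commute (mono ε p q α) (mono ε p q β)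
  ne_zero : halfProd (involutions ε c L) ≠ 0

theorem commute_pairGen_mono (c : Fin (m + m) ↪ Fin (p + q)) {α : Finset (Fin (p + q))}
    (hα : (α : Set (Fin (p + q))) ⊆ (Set.range c)ᶜ) (j : Fin m) :
    Commute (pairGen ε c j) (mono ε p q α) :=
  commute_gen_mul_gen (I := (Set.range c)ᶜ) (by simp) (by simp) (mono_mem_adjoin hα)

theorem halfProd_ofFn_pairGen (c : Fin (m + m) ↪ Fin (p + q)) :
    halfProd (List.ofFn (pairGen ε c)) = ((2 : ℝ) ^ m)⁻¹ • pairProd ε c := by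
  rw [halfProd_eq_smul, List.length_ofFn, List.map_ofFn, pairProd]
  rfl

/-- The empty list is admissible because `pairProd` is nonzero. Lists without repetition in a finite
type have bounded length, so extension must stop. -/
theorem exists_maximal_isAdmissible (hε : ε = 1 ∨ ε = -1) (c : Fin (m + m) ↪ Fin (p + q)) :
    ∃ L, IsAdmissible ε c L ∧ ∀ β, ¬ IsAdmissible ε c (β :: L) := by
  by_contra! hcon
  have : ∀ n : ℕ, ∃ L, IsAdmissible ε c L ∧ L.length = n := by
    intro n
    induction n with
    | zero =>
      refine ⟨[], ⟨List.nodup_nil, by simp, by simp, by simp, ?_⟩, rfl⟩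
      rw [involutions, List.map_nil, List.append_nil, halfProd_ofFn_pairGen]
      exact smul_ne_zero (by positivity) (pairProd_ne_zero hε c)
    | succ n ih =>
      obtain ⟨L, hL, rfl⟩ := ih
      obtain ⟨β, hβ⟩ := hcon L hL
      exact ⟨β :: L, hβ, rfl⟩
  obtain ⟨L, hL, hn⟩ := this (Fintype.card (Finset (Fin (p + q))) + 1)
  have := hL.nodup.length_le_card
  omega

namespace IsAdmissible

variable {c : Fin (m + m) ↪ Fin (p + q)} {L : List (Finset (Fin (p + q)))}

theorem commute_of_mem (hL : IsAdmissible ε c L) :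
    ∀ x ∈ involutions ε c L, ∀ y ∈ involutions ε c L, Commute x y := by
  intro x hx y hy
  simp only [involutions, List.mem_append, List.mem_ofFn, List.mem_map] at hx hy
  rcases hx with ⟨i, rfl⟩ | ⟨α, hα, rfl⟩ <;> rcases hy with ⟨j, rfl⟩ | ⟨β, hβ, rfl⟩
  · exact commute_pairGen c i j
  · exact commute_pairGen_mono c (hL.subset β hβ) i
  · exact (commute_pairGen_mono c (hL.subset α hα) j).symm
  · exact hL.comm α hα β hβ

theorem mul_self_of_mem (hL : IsAdmissible ε c L) (hε : ε = 1 ∨ ε = -1)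
    (hc : ∀ k, (c k : ℕ) < p ↔ (k : ℕ) < m) : ∀ x ∈ involutions ε c L, x * x = 1 := by
  intro x hx
  simp only [involutions, List.mem_append, List.mem_ofFn, List.mem_map] at hx
  rcases hx with ⟨i, rfl⟩ | ⟨α, hα, rfl⟩
  · exact pairGen_mul_self hε c hc i
  · exact hL.sq α hα

/-- This is where maximality enters. A `β` in `L` is absorbed; for any other `β`, the list `β :: L`
can fail only the nonvanishing condition, and `(1 + e_β) h = 0` says that `e_β` acts as `-1`. -/
theorem signEq_mono_mul (hL : IsAdmissible ε c L) (hε : ε = 1 ∨ ε = -1)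
    (hc : ∀ k, (c k : ℕ) < p ↔ (k : ℕ) < m) (hmax : ∀ β, ¬ IsAdmissible ε c (β :: L))
    {β : Finset (Fin (p + q))} (hβ : (β : Set (Fin (p + q))) ⊆ (Set.range c)ᶜ)
    (hsq : mono ε p q β * mono ε p q β = 1)
    (hcomm : ∀ α ∈ L, Commute (mono ε p q β) (mono ε p q α)) :
    SignEq (mono ε p q β * halfProd (involutions ε c L)) (halfProd (involutions ε c L)) := by
  by_cases hmem : β ∈ L
  · left
    refine mul_halfProd_of_mem hL.commute_of_mem (hL.mul_self_of_mem hε hc) ?_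
    exact List.mem_append_right _ (List.mem_map_of_mem hmem)
  right
  have h0 : halfProd (involutions ε c (β :: L)) = 0 := by
    by_contra hne
    refine hmax β ⟨List.nodup_cons.2 ⟨hmem, hL.nodup⟩, ?_, ?_, ?_, hne⟩
    · simpa [hβ] using hL.subset
    · simpa [hsq] using hL.sq
    · intro α hα α' hα'
      rcases List.mem_cons.1 hα with h1 | h1 <;> rcases List.mem_cons.1 hα' with h2 | h2
      · rw [h1, h2]
      · rw [h1]; exact hcomm _ h2
      · rw [h2]; exact (hcomm _ h1).symm
      · exact hL.comm _ h1 _ h2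
  have hb : Commute (mono ε p q β) (halfProd (List.ofFn (pairGen ε c))) := by
    refine commute_halfProd fun x hx => ?_
    obtain ⟨j, rfl⟩ := List.mem_ofFn.1 hx
    exact (commute_pairGen_mono c hβ j).symm
  rw [involutions, List.map_cons, halfProd_append, halfProd_cons, ← mul_assoc, mul_smul_comm,
    mul_add, mul_one, ← hb.eq, smul_mul_assoc, smul_eq_zero_iff_right (by norm_num), add_mul,
    mul_assoc, ← halfProd_append] at h0
  exact eq_neg_of_add_eq_zero_right h0

theorem isPrimitiveIdempotent (hL : IsAdmissible ε c L) (hε : ε = 1 ∨ ε = -1)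
    (hc : ∀ k, (c k : ℕ) < p ↔ (k : ℕ) < m) (hmax : ∀ β, ¬ IsAdmissible ε c (β :: L)) :
    IsPrimitiveIdempotent (halfProd (involutions ε c L)) := by
  have hK := hL.commute_of_mem
  have hsq := hL.mul_self_of_mem hε hc
  have hl : ∀ x ∈ involutions ε c L,
      x * halfProd (involutions ε c L) = halfProd (involutions ε c L) := fun x hx =>
    mul_halfProd_of_mem hK hsq hx
  have hr : ∀ x ∈ involutions ε c L,
      halfProd (involutions ε c L) * x = halfProd (involutions ε c L) := fun x hx =>
    halfProd_mul_of_mem hK hsq hx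
  have hpair : ∀ j, pairGen ε c j ∈ involutions ε c L := fun j =>
    List.mem_append_left _ (List.mem_ofFn.2 ⟨j, rfl⟩)
  have hmono : ∀ α ∈ L, mono ε p q α ∈ involutions ε c L := fun α hα =>
    List.mem_append_right _ (List.mem_map_of_mem hα)
  have hne := hL.ne_zero
  set h := halfProd (involutions ε c L) with hh
  have hanti : ∀ S, ∀ x ∈ involutions ε c L, ¬ Commute (mono ε p q S) x →
      mono ε p q S * x = -(x * mono ε p q S) := by
    intro S x hx hSx
    refine Or.resolve_left ?_ hSx
    simp only [involutions, List.mem_append, List.mem_ofFn, List.mem_map] at hx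
    rcases hx with ⟨j, rfl⟩ | ⟨α, hα, rfl⟩
    · obtain ⟨U, -, hU⟩ := exists_signEq_listMono hε (I := Set.univ)
        [c (Fin.castAdd m j), c (Fin.natAdd m j)] (by simp)
      have hU' : SignEq (pairGen ε c j) (mono ε p q U) := by simpa [pairGen] using hU
      exact (((SignEq.refl _).mul hU').trans (signEq_mono_mul_comm S U)).trans
        (hU'.symm.mul (SignEq.refl _))
    · exact signEq_mono_mul_comm S α
  refine isPrimitiveIdempotent_of_monomials (G := Set.range (mono ε p q)) (span_mono_eq_top hε)
    ?_ ?_ ?_ (isIdempotentElem_halfProd hK hsq) hne ?_ ?_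
  · rintro _ ⟨S, rfl⟩ _ ⟨T, rfl⟩
    obtain ⟨U, hU⟩ := exists_signEq_mono_mul_mono hε S T
    exact ⟨_, ⟨U, rfl⟩, hU⟩
  · rintro _ ⟨S, rfl⟩
    exact signEq_mono_mul_self hε S
  · rintro _ ⟨S, rfl⟩ _ ⟨T, rfl⟩
    exact signEq_mono_mul_comm S T
  · rintro _ ⟨S, rfl⟩
    by_cases hS : ∀ x ∈ involutions ε c L, Commute (mono ε p q S) x
    · exact Or.inr (commute_halfProd hS)
    · left
      push Not at hS
      obtain ⟨x, hx, hSx⟩ := hS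
      -- With `x` absorbed by `h` on both sides: `h e_S h = h e_S x h = -h x e_S h = -h e_S h`.
      refine self_eq_neg_real ?_
      nth_rw 2 [← hl x hx]
      rw [← mul_assoc, mul_assoc h, hanti S x hx hSx, mul_neg, neg_mul, ← mul_assoc, hr x hx]
  · rintro _ ⟨S, rfl⟩ hSh hSS
    have hS : ∀ x ∈ involutions ε c L, Commute (mono ε p q S) x := by
      intro x hx
      by_contra hSx
      -- Commuting with `h` forces commuting with every involution: otherwise `e_S h = e_S x h = -x
      -- h e_S = -e_S h`, contradicting that `e_S` is invertible and `h ≠ 0`.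
      have h1 : mono ε p q S * h = 0 := by
        refine self_eq_neg_real ?_
        nth_rw 1 [← hl x hx]
        rw [← mul_assoc, hanti S x hx hSx, neg_mul, mul_assoc, hSh.eq, ← mul_assoc, hl x hx]
      refine hne ?_
      rw [← one_mul h, ← hSS, mul_assoc, h1, mul_zero]
    obtain ⟨u, hu, T, hT, hST⟩ :=
      exists_signEq_mul_mono_compl hε c hc S fun j => (hS _ (hpair j)).symm
    have hucomm : ∀ y : Cl ε p q, (∀ j, Commute (pairGen ε c j) y) → Commute u y := by
      intro y hy
      clear hST
      induction hu using Submonoid.closure_induction with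
      | mem x hx => obtain ⟨j, rfl⟩ := hx; exact hy j
      | one => exact Commute.one_left y
      | mul a b _ _ ha hb => exact ha.mul_left hb
    have hu1 : u * h = h := by
      clear hST hucomm
      induction hu using Submonoid.closure_induction with
      | mem x hx => obtain ⟨j, rfl⟩ := hx; exact hl _ (hpair j)
      | one => exact one_mul h
      | mul a b _ _ ha hb => rw [mul_assoc, hb, ha]
    have huu : u * u = 1 := by
      have : ∀ v ∈ Submonoid.closure (Set.range (pairGen ε c)), v * v = 1 ∧
          ∀ j, Commute (pairGen ε c j) v := by
        intro v hv
        induction hv using Submonoid.closure_induction with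
        | mem x hx =>
          obtain ⟨i, rfl⟩ := hx
          exact ⟨pairGen_mul_self hε c hc i, fun j => commute_pairGen c j i⟩
        | one => exact ⟨one_mul 1, fun j => Commute.one_right _⟩
        | mul a b ha' _ ha hb =>
          refine ⟨?_, fun j => (ha.2 j).mul_right (hb.2 j)⟩
          have hab : Commute b a := by
            clear ha
            induction ha' using Submonoid.closure_induction with
            | mem x hx => obtain ⟨i, rfl⟩ := hx; exact (hb.2 i).symm
            | one => exact Commute.one_right b
            | mul x y _ _ hx hy => exact hx.mul_right hy
          rw [hab.mul_mul_mul_comm, ha.1, hb.1, one_mul]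
      exact (this u hu).1
    have huT : Commute u (mono ε p q T) := hucomm _ fun j => commute_pairGen_mono c hT j
    -- Since `u` is an involution commuting with `e_T`, the square of `e_S` passes to `e_T`.
    -- Likewise `e_T = ± u e_S` commutes with the monomials of `L`, so maximality applies to `T`.
    have hTT : mono ε p q T * mono ε p q T = 1 := by
      rw [← hSS, hST.mul_self_eq, huT.symm.mul_mul_mul_comm, huu, one_mul]
    have hTS : SignEq (u * mono ε p q S) (mono ε p q T) := by
      have := (SignEq.refl u).mul hST
      rwa [← mul_assoc, huu, one_mul] at this
    have hTh := hL.signEq_mono_mul hε hc hmax hT hTT fun α hα =>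
      hTS.commute_left ((hucomm _ fun j => commute_pairGen_mono c (hL.subset α hα) j).mul_left
        (hS _ (hmono α hα)))
    have h2 := hST.mul (SignEq.refl h)
    rw [mul_assoc] at h2
    have h3 := (SignEq.refl u).mul hTh
    rw [hu1] at h3
    exact h2.trans h3

end IsAdmissible

/-! ### Forms in selected coordinates and the choice of `c` -/

theorem symbol_mem_range_pull (hε : ε = 1 ∨ ε = -1) {n : ℕ} (d : Fin n ↪ Fin (p + q))
    {x : Cl ε p q} (hx : x ∈ Algebra.adjoin ℝ (gen ε p q '' Set.range d)) :
    symbol ε p q x ∈ (pull d).range := by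
  replace hx := adjoin_gen_le_span_mono hε _ hx
  induction hx using Submodule.span_induction with
  | mem x hx =>
    obtain ⟨S, hS, rfl⟩ := hx
    rw [symbol_mono]
    refine Subalgebra.list_prod_mem _ fun y hy => ?_
    obtain ⟨i, hi, rfl⟩ := List.mem_map.1 hy
    obtain ⟨k, rfl⟩ := hS (by simpa using hi : i ∈ (S : Set (Fin (p + q))))
    exact ⟨covec k, pull_covec d k⟩
  | zero => rw [map_zero]; exact zero_mem _
  | add x y _ _ hx hy => rw [map_add]; exact add_mem hx hy
  | smul r x _ hx => rw [map_smul]; exact Subalgebra.smul_mem _ hx r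

/-- The choice of the first `m` positive and the first `m` negative coordinates. -/
theorem exists_coord_embedding (hp : m ≤ p) (hq : m ≤ q) :
    ∃ c : Fin (m + m) ↪ Fin (p + q), ∀ k, (c k : ℕ) < p ↔ (k : ℕ) < m := by
  refine ⟨⟨fun k => ⟨if (k : ℕ) < m then k else p + (k - m), ?_⟩, fun k l hkl => ?_⟩, fun k => ?_⟩
  · have := k.2
    split_ifs <;> omega
  · simp only [Fin.mk.injEq] at hkl
    apply Fin.ext
    have := k.2
    have := l.2
    split_ifs at hkl <;> omega
  · change (if (k : ℕ) < m then (k : ℕ) else p + (k - m)) < p ↔ _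
    split_ifs <;> omega

end PrimitiveMonomials

end

/-! ### Assembly of the theorem -/

theorem proposition4p3 (ε : ℝ) (hε : ε = 1 ∨ ε = -1) (p q : ℕ) (hpq : p ≠ q)
    (hp : p ≠ 0) (hq : q ≠ 0) (hq1 : q ≠ p + 1) (hq2 : q ≠ p + 2)
    (m : ℕ) (hm : m = min p q) :
    ∃ (c : Fin (m + m) ↪ Fin (p + q)) (d : Fin (p + q - 2 * m) ↪ Fin (p + q))
      (f e h : Cl ε p q) (s : Fin m → Cl ε p q)
      (r : ℕ) (α : Fin r → Finset (Fin (p + q))),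
      -- `c` and `d` split the coordinates of `ℝ^(p+q)` into `ℝ^(2m)` and its complement
      Set.range d = (Set.range c)ᶜ ∧
      -- `f` is the product of the `1 + s j`, with commuting involutions `s j` of degree two
      (∀ j, s j = gen ε p q (c (Fin.castAdd m j)) * gen ε p q (c (Fin.natAdd m j))) ∧
      (∀ j, s j * s j = 1) ∧
      (∀ i j, Commute (s i) (s j)) ∧
      f = (List.ofFn fun j => 1 + s j).prod ∧
      -- `f` recovers the `U(m)`-structure by projection, through its degree two component
      RecoversByProjection ε p q c f (stdUnitary m) ∧
      symbol ε p q (gradePart ε p q 2 f) = pull c (stdUnitary m).ω ∧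
      symbol ε p q f = kahlerPoly m (pull c (stdUnitary m).ω) ∧
      -- `e` is a product of further commuting idempotents, in the complementary coordinates
      (∀ i, (α i : Set (Fin (p + q))) ⊆ Set.range d) ∧
      (∀ i, mono ε p q (α i) * mono ε p q (α i) = 1) ∧
      (∀ i j, Commute (mono ε p q (α i)) (mono ε p q (α j))) ∧
      (∀ i j, Commute (mono ε p q (α i)) (s j)) ∧
      e = (List.ofFn fun i => (2 : ℝ)⁻¹ • (1 + mono ε p q (α i))).prod ∧
      -- `h` is a primitive idempotent with factor `f`, and its symbol splits
      IsPrimitiveIdempotent h ∧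
      h = ((2 : ℝ) ^ m)⁻¹ • (f * e) ∧
      symbol ε p q h = ratKahlerPoly m (pull c (stdUnitary m).ω) * symbol ε p q e ∧
      symbol ε p q e ∈ (pull d).range := by
  obtain ⟨c, hc⟩ := exists_coord_embedding (p := p) (q := q) (m := m) (by omega) (by omega)
  have hcard : (Finset.univ.map c)ᶜ.card = p + q - 2 * m := by
    rw [Finset.card_compl, Finset.card_map, Finset.card_univ, Fintype.card_fin, Fintype.card_fin]
    omega
  obtain ⟨d, hd⟩ : ∃ d : Fin (p + q - 2 * m) ↪ Fin (p + q), Set.range d = (Set.range c)ᶜ :=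
    ⟨((Finset.univ.map c)ᶜ.orderEmbOfFin hcard).toEmbedding, by
      ext i
      simp [Finset.range_orderEmbOfFin]⟩
  obtain ⟨L, hL, hmax⟩ := exists_maximal_isAdmissible hε c
  have hmem : ∀ i : Fin L.length, L.get i ∈ L := fun i => List.get_mem L i
  have he : halfProd (L.map (mono ε p q)) =
      (List.ofFn fun i => (2 : ℝ)⁻¹ • (1 + mono ε p q (L.get i))).prod := by
    conv_lhs => rw [← List.ofFn_get L]
    rw [halfProd, List.map_ofFn, List.map_ofFn]
    rfl
  have hh : halfProd (involutions ε c L) =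
      ((2 : ℝ) ^ m)⁻¹ • (pairProd ε c * halfProd (L.map (mono ε p q))) := by
    rw [involutions, halfProd_append, halfProd_ofFn_pairGen, smul_mul_assoc]
  have hein : halfProd (L.map (mono ε p q)) ∈
      Algebra.adjoin ℝ (gen ε p q '' (Set.range c)ᶜ) := by
    refine Subalgebra.list_prod_mem _ fun x hx => ?_
    simp only [List.mem_map, exists_exists_and_eq_and] at hx
    obtain ⟨α, hα, rfl⟩ := hx
    exact Subalgebra.smul_mem _ (Subalgebra.add_mem _ (Subalgebra.one_mem _)
      (mono_mem_adjoin (hL.subset α hα))) _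
  have hfin : pairProd ε c ∈ Algebra.adjoin ℝ (gen ε p q '' Set.range c) := by
    rw [← Set.range_comp]
    exact pairProd_mem_coordSubalgebra c
  -- The strict inequality `m + m < p + q` holds because `m = min p q` and `p ≠ q`.
  refine ⟨c, d, pairProd ε c, halfProd (L.map (mono ε p q)), halfProd (involutions ε c L),
    pairGen ε c, L.length, L.get, hd, fun _ => rfl, pairGen_mul_self hε c hc, commute_pairGen c,
    rfl, recoversByProjection_pairProd hε c hc (by omega), symbol_gradePart_pairProd hε c,
    symbol_pairProd hε c, fun i => hd ▸ hL.subset _ (hmem i), fun i => hL.sq _ (hmem i),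
    fun i j => hL.comm _ (hmem i) _ (hmem j),
    fun i j => (commute_pairGen_mono c (hL.subset _ (hmem i)) j).symm, he,
    hL.isPrimitiveIdempotent hε hc hmax, hh, ?_,
    symbol_mem_range_pull hε d (by rw [hd]; exact hein)⟩
  -- The two factors of `h` live on complementary sets of generators, so the symbol is
  -- multiplicative on them.
  rw [hh, map_smul, symbol_mul_of_disjoint hε disjoint_compl_right hfin hein,
    symbol_pairProd hε, ratKahlerPoly, smul_mul_assoc]
  rfl
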